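/- Let $\mathcal F$ be the set of probability distributions $F$ on $[0,\infty)$ with finite positive mean and $\inf\{y:F(y)>0\}<\sup\{y:F(y)<1\}$. For $F\in\mathcal F$ let $X,X_1,X_2,\dots$ be i.i.d. with law $F$. In the prophet inequality over time, when a value $X$ is observed with $m$ periods to go, the decision-maker chooses a duration $\tau\in\{1,\dots,m\}$, earns $\tau X$, and continues with $m-\tau$ periods to go. Let $G_m(F)$ be the value of the optimal dynamic programming policy, i.e. $G_0(F)=0$ and $G_m(F)=\mathbf E\big[\max_{1\le\tau\le m}(\tau X+G_{m-\tau}(F))\big]$, and let $E_n(F)=\sum_{\ell=1}^n\mathbf E[\max\{X_1,\dots,X_\ell\}]$ be the optimal offline value. Put $$\gamma_n=\inf_{F\in\mathcal F}\frac{G_n(F)}{E_n(F)},\qquad \varepsilon_n=\inf\{\varepsilon\ge0:(1+\varepsilon)G_n(F)-E_n(F)\ge0\text{ for every }F\in\mathcal F\}.$$ For $n\ge2$ let $P_n(t)=n-\sum_{\ell=1}^nt^\ell$; for $y\in\mathbb R^{n-1}$ and $1\le j\le n-2$ let $A_j(y)=\frac{j+2}{j+1}y_{j+1}-\frac1{j(j+1)}\sum_{\ell=1}^jy_\ell$;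 let $$L_{n,\varepsilon}(y)=(1+\varepsilon)n\Big(1+\sum_{j=1}^{n-1}y_j\Big)-\frac{n(n+1)}{2(n-1)}\Big(n\sum_{j=1}^{n-1}y_j-(n-1)\sum_{j=1}^{n-2}y_j\Big),$$ $$\Upsilon_{n,\varepsilon}(y)=L_{n,\varepsilon}(y)-P_n(2y_1)-\sum_{j=1}^{n-2}y_jP_n\big(A_j(y)/y_j\big),$$ $$K_n=\{y\in\mathbb R^{n-1}_{+}:A_j(y)\ge0\text{ for }1\le j\le n-2\}.$$ On points of $K_n$ with some $y_j=0$, $j\le n-2$, the summand $y_jP_n(A_j/y_j)$ is read as $0$ if $A_j=0$ and as $-\infty$ (so that $\Upsilon_{n,\varepsilon}=+\infty$) if $A_j>0$. Theorem. For every $n\ge1$, $\gamma_n=1/(1+\varepsilon_n)$. For every $n\ge2$ there is $\varepsilon_n'\ge\varepsilon_n$ such that for every $\varepsilon\in[\varepsilon_n,\varepsilon_n']$: (i) $(1+\varepsilon)G_n(F)\ge E_n(F)$ for every $F\in\mathcal F$ if and only if the optimal value of $\min\{\Upsilon_{n,\varepsilon}(y):y\in K_n\}$ is non-negative; (ii)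 there is exactly one point $y^\star\in K_n$ with $\nabla\Upsilon_{n,\varepsilon}(y^\star)=0$, and $y^\star$ is the unique global minimiser of $\Upsilon_{n,\varepsilon}$ over $K_n$. Moreover, for $n\ge2$, $\gamma_n$ is determined by a convex program: for every $\varepsilon\ge0$ the function $\Upsilon_{n,\varepsilon}$ is convex on the set of points of $K_n$ where it is finite, and $\varepsilon_n$ is the smallest $\varepsilon\ge0$ for which the infimum of $\Upsilon_{n,\varepsilon}$ over $K_n$ is non-negative. -/

import Mathlib

open MeasureTheory ProbabilityTheory

noncomputable section

namespace POT

/-- Left endpoint `inf {y : F(y) > 0}` of the support of a distribution on the line. -/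
def omega0 (F : ProbabilityMeasure ℝ) : EReal :=
  sInf ((fun y : ℝ => (y : EReal)) '' {y : ℝ | 0 < cdf (F : Measure ℝ) y})

/-- Right endpoint `sup {y : F(y) < 1}` of the support, possibly `+∞`. -/
def omega1 (F : ProbabilityMeasure ℝ) : EReal :=
  sSup ((fun y : ℝ => (y : EReal)) '' {y : ℝ | cdf (F : Measure ℝ) y < 1})

/-- The class of distributions over the non-negative reals with finite positive expectation
and with non-degenerate support. -/
def distributions : Set (ProbabilityMeasure ℝ) :=
  {F | (F : Measure ℝ) (Set.Iio 0) = 0 ∧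
       Integrable (fun x : ℝ => x) (F : Measure ℝ) ∧
       0 < ∫ x, x ∂(F : Measure ℝ) ∧
       omega0 F < omega1 F}

/-- Value of the optimal dynamic programming policy with `m` periods to go. When a value `x` is
observed with `m + 1` periods to go, the decision-maker keeps it for `k + 1` of them, where
`0 ≤ k ≤ m`, earns `(k + 1) * x`, and continues optimally with `m - k` periods to go. -/
def G (F : ProbabilityMeasure ℝ) : ℕ → ℝ
  | 0 => 0
  | m + 1 =>
      ∫ x, Finset.univ.sup' Finset.univ_nonempty
        (fun k : Fin (m + 1) => ((k : ℕ) + 1 : ℝ) * x + G F (m - (k : ℕ))) ∂(F : Measure ℝ)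
termination_by m => m
decreasing_by omega

/-- Optimal offline value: the sum over `ℓ = 1, …, n` of the expected maximum of `ℓ` independent
samples of `F`. -/
def E (F : ProbabilityMeasure ℝ) (n : ℕ) : ℝ :=
  ∑ ℓ ∈ Finset.range n,
    ∫ x : Fin (ℓ + 1) → ℝ, Finset.univ.sup' Finset.univ_nonempty x
      ∂(Measure.pi fun _ : Fin (ℓ + 1) => (F : Measure ℝ))

/-- Worst-case approximation ratio of the optimal policy with `n` periods. -/
def gamma (n : ℕ) : ℝ :=
  sInf ((fun F : ProbabilityMeasure ℝ => G F n / E F n) '' distributions)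

/-- The infimum of the `ε ≥ 0` such that `(1 + ε) G_n(F) ≥ E_n(F)` for all admissible `F`. -/
def eps (n : ℕ) : ℝ :=
  sInf {ε : ℝ | 0 ≤ ε ∧ ∀ F ∈ distributions, 0 ≤ (1 + ε) * G F n - E F n}

/-- The polynomial `P_n(t) = n - ∑_{ℓ=1}^n t^ℓ`. -/
def P (n : ℕ) (t : ℝ) : ℝ := n - ∑ ℓ ∈ Finset.Icc 1 n, t ^ ℓ

/-- The coordinate `y_j` of `y ∈ ℝ^{n-1}`, with coordinates numbered `1, …, n-1`. -/
def coord (n : ℕ) (y : EuclideanSpace ℝ (Fin (n - 1))) (j : ℕ) : ℝ :=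
  if h : 1 ≤ j ∧ j ≤ n - 1 then y ⟨j - 1, by omega⟩ else 0

/-- `A_j(y_1, …, y_{j+1})`, for `1 ≤ j ≤ n - 2`. -/
def A (n j : ℕ) (y : EuclideanSpace ℝ (Fin (n - 1))) : ℝ :=
  ((j : ℝ) + 2) / ((j : ℝ) + 1) * coord n y (j + 1)
    - 1 / ((j : ℝ) * ((j : ℝ) + 1)) * ∑ ℓ ∈ Finset.Icc 1 j, coord n y ℓ

/-- The affine part `L_{n,ε}` of the objective. -/
def L (n : ℕ) (ε : ℝ) (y : EuclideanSpace ℝ (Fin (n - 1))) : ℝ :=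
  (1 + ε) * n * (1 + ∑ j ∈ Finset.Icc 1 (n - 1), coord n y j)
    - (n : ℝ) * ((n : ℝ) + 1) / (2 * ((n : ℝ) - 1))
      * ((n : ℝ) * ∑ j ∈ Finset.Icc 1 (n - 1), coord n y j
          - ((n : ℝ) - 1) * ∑ j ∈ Finset.Icc 1 (n - 2), coord n y j)

/-- The function `Υ_{n,ε}`, as a real-valued formula; it is meaningful where
`y_1, …, y_{n-2}` do not vanish. -/
def Upsilon (n : ℕ) (ε : ℝ) (y : EuclideanSpace ℝ (Fin (n - 1))) : ℝ :=
  L n ε y - P n (2 * coord n y 1)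
    - ∑ j ∈ Finset.Icc 1 (n - 2), coord n y j * P n (A n j y / coord n y j)

/-- The polyhedron `K_n`. -/
def K (n : ℕ) : Set (EuclideanSpace ℝ (Fin (n - 1))) :=
  {y | (∀ j ∈ Finset.Icc 1 (n - 1), 0 ≤ coord n y j) ∧
       ∀ j ∈ Finset.Icc 1 (n - 2), 0 ≤ A n j y}

/-- The points at which every summand `y_j P_n(A_j / y_j)` has a finite value, with the usual
convention for perspective functions: for `y_j = 0` the summand is `0` if `A_j = 0`, and it is
`-∞`, its limit as `y_j` decreases to `0`, if `A_j > 0`. -/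
def dom (n : ℕ) : Set (EuclideanSpace ℝ (Fin (n - 1))) :=
  {y | ∀ j ∈ Finset.Icc 1 (n - 2), coord n y j = 0 → A n j y = 0}

open Classical in
/-- `Υ_{n,ε}` on all of `K_n`, with the value `+∞` where some summand `y_j P_n(A_j / y_j)`
is `-∞`. -/
def objective (n : ℕ) (ε : ℝ) (y : EuclideanSpace ℝ (Fin (n - 1))) : EReal :=
  if y ∈ dom n then (Upsilon n ε y : EReal) else ⊤

/-- Optimal value of the problem of minimising `Υ_{n,ε}` over `K_n`. -/
def optValue (n : ℕ) (ε : ℝ) : EReal := ⨅ y ∈ K n, objective n ε y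

end POT

end

namespace POT

/-! The maximum of ℓ samples has distribution function F^ℓ, so E_n is the integral of P_n(F(x)) over
x > 0. Online, it is always optimal to keep a value for one period or for all remaining ones; hence
G_m = m t_m with increasing thresholds satisfying (m+1) t_{m+1} = t_1 + m t_m + m ψ(t_m), where t_1
is the mean and ψ the mean excess (`G_eq`). Cut the half-line at the thresholds and put y_j =
t_{j+1} - t_j. The recursion makes A_j(y) the integral of F over (t_j, t_{j+1}] (`seqA_thr`), so
concavity of P_n bounds that piece of E_n by y_j P_n(A_j/y_j). Scaling the mean to 1 gives Υ.

Now bound each concave piece by a tangent line, at u_j on the j-th interval and at 1 on the tail.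
Everything becomes linear in y, and `IsChain` collects the equations under which all coefficients of
y cancel (`IsChain.total`), leaving the constant (1+ε)n - icp n (u 0). Thus Υ is this constant plus
tangency gaps (`Upsilon_eq`). On K_n, where Υ is finite, the gaps are non-negative, and all vanish
only if 2y_1 = u_0 and A_j = u_j y_j: this is the unique minimiser. Applied to the thresholds of F,
the same identity gives E_n ≤ (1+e) G_n when the constant is zero at ε = e (`E_le`). Laws whose
distribution function equals u_j between thresholds make every bound tight except that of the tail,
which is approached in a limit (`exists_law`); so ε_n = e.

A chain is found by shooting: its slopes are run backwards from the tangent at 1, and the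
intermediate value theorem fixes the free slope (`exists_isChain`). Openness leaves room for ε
slightly above e. -/

/-! ### Tangent lines to P_n and strict concavity -/

/-- Minus the slope of the tangent line to `P n` at `t`. -/
noncomputable def slp (n : ℕ) (t : ℝ) : ℝ := ∑ l ∈ Finset.Icc 1 n, (l : ℝ) * t ^ (l - 1)

/-- The intercept of the tangent line to `P n` at `t`. -/
noncomputable def icp (n : ℕ) (t : ℝ) : ℝ := P n t + t * slp n t

lemma pow_tangent {t v : ℝ} (ht : 0 ≤ t) (hv : 0 ≤ v) (k : ℕ) :
    ((k : ℝ) + 1) * v ^ k * t - k * v ^ (k + 1) ≤ t ^ (k + 1) := by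
  induction k with
  | zero => simp
  | succ k ih =>
    have h1 := mul_le_mul_of_nonneg_left ih ht
    have h2 : 0 ≤ ((k : ℝ) + 1) * v ^ k * (t - v) ^ 2 := by positivity
    push_cast
    calc _ = t * (((k : ℝ) + 1) * v ^ k * t - k * v ^ (k + 1))
            - ((k : ℝ) + 1) * v ^ k * (t - v) ^ 2 := by ring
      _ ≤ t * t ^ (k + 1) := by linarith
      _ = _ := by ring

/-- The gap splits over monomials into the tangency gaps of the convex functions t^l. -/
lemma tangent_sub_P (n : ℕ) (t v : ℝ) :
    icp n v - slp n v * t - P n t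
      = ∑ l ∈ Finset.Icc 1 n, (t ^ l - ((l : ℝ) * v ^ (l - 1) * t - (l - 1) * v ^ l)) := by
  have h : v * slp n v = ∑ l ∈ Finset.Icc 1 n, (l : ℝ) * v ^ l := by
    rw [slp, Finset.mul_sum]
    refine Finset.sum_congr rfl fun l hl => ?_
    obtain ⟨k, rfl⟩ : ∃ k, l = k + 1 := ⟨l - 1, by have := (Finset.mem_Icc.1 hl).1; omega⟩
    simp only [Nat.add_sub_cancel]; ring
  have h' : slp n v * t = ∑ l ∈ Finset.Icc 1 n, (l : ℝ) * v ^ (l - 1) * t := by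
    rw [slp, Finset.sum_mul]
  rw [icp, h, h', P, P]
  simp only [sub_mul, one_mul, Finset.sum_sub_distrib]
  ring

lemma tangent_term_nonneg {t v : ℝ} (ht : 0 ≤ t) (hv : 0 ≤ v) {l : ℕ} (hl : 1 ≤ l) :
    0 ≤ t ^ l - ((l : ℝ) * v ^ (l - 1) * t - (l - 1) * v ^ l) := by
  obtain ⟨k, rfl⟩ : ∃ k, l = k + 1 := ⟨l - 1, by omega⟩
  have := pow_tangent ht hv k
  push_cast
  simp only [add_sub_cancel_right]
  linarith

lemma P_le_tangent {n : ℕ} {t v : ℝ} (ht : 0 ≤ t) (hv : 0 ≤ v) :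
    P n t ≤ icp n v - slp n v * t := by
  rw [← sub_nonneg, tangent_sub_P]
  exact Finset.sum_nonneg fun l hl => tangent_term_nonneg ht hv (Finset.mem_Icc.1 hl).1

lemma P_lt_tangent {n : ℕ} (hn : 2 ≤ n) {t v : ℝ} (ht : 0 ≤ t) (hv : 0 ≤ v) (h : t ≠ v) :
    P n t < icp n v - slp n v * t := by
  rw [← sub_pos, tangent_sub_P]
  -- The term l = 2 is (t - v)^2; this is where n ≥ 2 enters.
  refine Finset.sum_pos' (fun l hl => tangent_term_nonneg ht hv (Finset.mem_Icc.1 hl).1)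
    ⟨2, Finset.mem_Icc.2 ⟨by norm_num, hn⟩, ?_⟩
  have : 0 < (t - v) ^ 2 := by
    have := sub_ne_zero.2 h
    positivity
  norm_num
  nlinarith

lemma slp_mono {n : ℕ} {x y : ℝ} (hx : 0 ≤ x) (hxy : x ≤ y) : slp n x ≤ slp n y :=
  Finset.sum_le_sum fun l _ => by gcongr

lemma slp_zero {n : ℕ} (hn : 1 ≤ n) : slp n 0 = 1 := by
  rw [slp, Finset.sum_eq_single 1]
  · simp
  · intro b hb hb1
    have : b - 1 ≠ 0 := by have := (Finset.mem_Icc.1 hb).1; omega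
    simp [this]
  · intro h; exact absurd (Finset.mem_Icc.2 ⟨le_rfl, hn⟩) h

lemma slp_strictMono {n : ℕ} (hn : 2 ≤ n) {x y : ℝ} (hx : 0 ≤ x) (hxy : x < y) :
    slp n x < slp n y := by
  refine Finset.sum_lt_sum (fun l _ => by gcongr) ⟨2, Finset.mem_Icc.2 ⟨by norm_num, hn⟩, ?_⟩
  norm_num; exact hxy

lemma sum_Icc_cast (n : ℕ) : ∑ l ∈ Finset.Icc 1 n, (l : ℝ) = n * (n + 1) / 2 := by
  induction n with
  | zero => simp
  | succ n ih => rw [Finset.sum_Icc_succ_top (by omega), ih]; push_cast; ring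

lemma slp_one (n : ℕ) : slp n 1 = n * (n + 1) / 2 := by
  simp [slp, sum_Icc_cast]

lemma P_one (n : ℕ) : P n 1 = 0 := by simp [P]

lemma P_zero (n : ℕ) : P n 0 = n := by
  rw [P, Finset.sum_eq_zero]
  · simp
  · intro l hl
    have := (Finset.mem_Icc.1 hl).1
    simp; omega

lemma icp_zero (n : ℕ) : icp n 0 = n := by simp [icp, P_zero]

lemma icp_one (n : ℕ) : icp n 1 = slp n 1 := by simp [icp, P_one]

@[fun_prop] lemma continuous_P (n : ℕ) : Continuous (P n) := by unfold P; fun_prop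
@[fun_prop] lemma continuous_slp (n : ℕ) : Continuous (slp n) := by unfold slp; fun_prop
@[fun_prop] lemma continuous_icp (n : ℕ) : Continuous (icp n) := by unfold icp; fun_prop

lemma icp_mono {n : ℕ} {x y : ℝ} (hx : 0 ≤ x) (hxy : x ≤ y) : icp n x ≤ icp n y := by
  have h1 := P_le_tangent (n := n) hx (hx.trans hxy)
  have h2 := slp_mono (n := n) hx hxy
  have h3 : icp n x = P n x + x * slp n x := rfl
  nlinarith

lemma icp_lt {n : ℕ} (hn : 2 ≤ n) {x : ℝ} (hx : 0 < x) : (n : ℝ) < icp n x := by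
  have h1 := P_lt_tangent hn le_rfl hx.le hx.ne
  rw [P_zero] at h1
  linarith

/-- Along the tangents d icp = t d slp, so the intercept is a 1-Lipschitz function of the slope
while t ≤ 1. -/
lemma icp_sub_le {n : ℕ} {x y : ℝ} (hx : 0 ≤ x) (hxy : x ≤ y) (hy : y ≤ 1) :
    icp n y - icp n x ≤ slp n y - slp n x := by
  have h1 := P_le_tangent (n := n) (hx.trans hxy) hx
  have h2 := slp_mono (n := n) hx hxy
  have h3 : icp n y = P n y + y * slp n y := rfl
  nlinarith

/-- The tangent at v, read at 1 where P vanishes. It controls the last interval of the extremal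
laws. -/
lemma one_sub_mul_slp_le_P {n : ℕ} {v : ℝ} (hv : 0 ≤ v) : (1 - v) * slp n v ≤ P n v := by
  have h1 := P_le_tangent (n := n) zero_le_one hv
  rw [P_one, icp] at h1
  linarith

/-! ### The intercept as a function of the slope -/

/-- The increasing homeomorphism of the line that extends `slp n` from `[0, ∞)`. -/
noncomputable def slpExt (n : ℕ) (t : ℝ) : ℝ := slp n (max t 0) + min t 0

lemma slpExt_of_nonneg {n : ℕ} {t : ℝ} (ht : 0 ≤ t) : slpExt n t = slp n t := by
  simp [slpExt, ht]

lemma slpExt_strictMono {n : ℕ} (hn : 2 ≤ n) : StrictMono (slpExt n) := by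
  intro x y hxy
  unfold slpExt
  rcases le_or_gt y 0 with hy | hy
  · rw [max_eq_right hy, max_eq_right (hxy.le.trans hy), min_eq_left hy,
      min_eq_left (hxy.le.trans hy)]
    linarith
  · have h1 : slp n (max x 0) < slp n (max y 0) :=
      slp_strictMono hn (le_max_right _ _) (by
        rw [max_eq_left hy.le]; exact max_lt hxy hy)
    have h2 : min x 0 ≤ min y 0 := min_le_min_right _ hxy.le
    linarith

lemma slp_ge {n : ℕ} (hn : 2 ≤ n) {t : ℝ} (ht : 0 ≤ t) : 1 + 2 * t ≤ slp n t := by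
  have : ∑ l ∈ Finset.Icc (1 : ℕ) 2, (l : ℝ) * t ^ (l - 1) ≤ slp n t :=
    Finset.sum_le_sum_of_subset_of_nonneg (Finset.Icc_subset_Icc_right hn)
      fun i _ _ => by positivity
  rw [show Finset.Icc (1 : ℕ) 2 = {1, 2} from rfl] at this
  simpa using this

lemma continuous_slpExt (n : ℕ) : Continuous (slpExt n) := by unfold slpExt; fun_prop

lemma slpExt_surjective {n : ℕ} (hn : 2 ≤ n) : Function.Surjective (slpExt n) := by
  refine (continuous_slpExt n).surjective ?_ ?_
  · refine Filter.tendsto_atTop_mono' _ ?_ Filter.tendsto_id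
    filter_upwards [Filter.eventually_ge_atTop 0] with t ht
    rw [slpExt_of_nonneg ht, id]
    linarith [slp_ge hn ht]
  · have h : Filter.Tendsto (fun t : ℝ => slp n 0 + t) Filter.atBot Filter.atBot :=
      Filter.tendsto_atBot_add_const_left _ _ Filter.tendsto_id
    refine h.congr' ?_
    filter_upwards [Filter.eventually_le_atBot 0] with t ht
    simp [slpExt, ht]

/-- The inverse of `slpExt n`. -/
noncomputable def slpIso (n : ℕ) (hn : 2 ≤ n) : ℝ ≃o ℝ :=
  (slpExt_strictMono hn).orderIsoOfSurjective _ (slpExt_surjective hn)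

lemma slpIso_apply {n : ℕ} (hn : 2 ≤ n) (t : ℝ) : slpIso n hn t = slpExt n t := rfl

/-- The intercept of the tangent line to `P n`, as a function of minus its slope. -/
noncomputable def conj (n : ℕ) (hn : 2 ≤ n) (b : ℝ) : ℝ := icp n (max ((slpIso n hn).symm b) 0)

lemma continuous_conj {n : ℕ} (hn : 2 ≤ n) : Continuous (conj n hn) := by
  have := (slpIso n hn).symm.continuous
  unfold conj
  fun_prop

lemma conj_mono {n : ℕ} (hn : 2 ≤ n) : Monotone (conj n hn) := fun _ _ hxy =>
  icp_mono (le_max_right _ _) (max_le_max_right _ ((slpIso n hn).symm.monotone hxy))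

lemma slpIso_symm_slp {n : ℕ} (hn : 2 ≤ n) {t : ℝ} (ht : 0 ≤ t) :
    (slpIso n hn).symm (slp n t) = t := by
  rw [← slpExt_of_nonneg ht, ← slpIso_apply hn, OrderIso.symm_apply_apply]

lemma conj_sub_le {n : ℕ} (hn : 2 ≤ n) {x y : ℝ} (hxy : x ≤ y) (hy : y ≤ slp n 1) :
    conj n hn y - conj n hn x ≤ y - x := by
  set s := (slpIso n hn).symm x with hs
  set t := (slpIso n hn).symm y with ht
  have hx' : x = slpExt n s := by rw [← slpIso_apply hn, hs, OrderIso.apply_symm_apply]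
  have hy' : y = slpExt n t := by rw [← slpIso_apply hn, ht, OrderIso.apply_symm_apply]
  have hst : s ≤ t := (slpIso n hn).symm.monotone hxy
  have ht1 : t ≤ 1 := by
    rw [← slpIso_symm_slp hn zero_le_one]; exact (slpIso n hn).symm.monotone hy
  have h1 := icp_sub_le (n := n) (le_max_right s 0) (max_le_max_right 0 hst)
    (max_le ht1 zero_le_one)
  have h2 : min s 0 ≤ min t 0 := min_le_min_right _ hst
  have : conj n hn y - conj n hn x = icp n (max t 0) - icp n (max s 0) := rfl
  rw [this, hx', hy', slpExt, slpExt]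
  linarith

/-! ### Existence of stationary chains by shooting -/

/-- The slopes along a stationary chain, listed from the right end, where the last slope is
`slp n 1` and the last but one is `w`. -/
noncomputable def slopeSeq (n : ℕ) (hn : 2 ≤ n) (w : ℝ) : ℕ → ℝ
  | 0 => slp n 1
  | 1 => w
  | i + 2 => slopeSeq n hn w (i + 1) - ((n - 2 - i : ℕ) : ℝ) / ((n - 2 - i : ℕ) + 1)
      * (conj n hn (slopeSeq n hn w i) - conj n hn (slopeSeq n hn w (i + 1)))

lemma slopeSeq_add_two {n : ℕ} (hn : 2 ≤ n) (w : ℝ) (i : ℕ) :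
    slopeSeq n hn w (i + 2) = slopeSeq n hn w (i + 1)
      - ((n - 2 - i : ℕ) : ℝ) / ((n - 2 - i : ℕ) + 1)
        * (conj n hn (slopeSeq n hn w i) - conj n hn (slopeSeq n hn w (i + 1))) := by
  rw [slopeSeq]

lemma continuous_slopeSeq {n : ℕ} (hn : 2 ≤ n) (i : ℕ) :
    Continuous fun w => slopeSeq n hn w i := by
  induction i using Nat.strong_induction_on with
  | _ i ih =>
    match i with
    | 0 => simp only [slopeSeq]; fun_prop
    | 1 => simp only [slopeSeq]; fun_prop
    | i + 2 =>
      have h1 := ih i (by omega)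
      have h2 := ih (i + 1) (by omega)
      have h3 := continuous_conj hn
      simp only [slopeSeq_add_two]
      fun_prop

/-- Monotonicity of `conj` makes each decrement non-negative. From i = n - 2 on, truncated
subtraction makes the weight 0 and the sequence stays constant, so no range restriction is needed.
-/
lemma slopeSeq_antitone {n : ℕ} (hn : 2 ≤ n) {w : ℝ} (hw : w ≤ slp n 1) :
    Antitone (slopeSeq n hn w) := by
  refine antitone_nat_of_succ_le fun i => ?_
  induction i with
  | zero => simpa only [slopeSeq] using hw
  | succ i ih =>
    rw [slopeSeq_add_two]
    have := conj_mono hn ih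
    have h2 : 0 ≤ ((n - 2 - i : ℕ) : ℝ) / ((n - 2 - i : ℕ) + 1) := by positivity
    nlinarith

/-- By the Lipschitz bound each decrement is at most k/(k+1) times the preceding one, with k = n - 2
- i, and the product of these factors telescopes. -/
lemma slopeSeq_sub_le {n : ℕ} (hn : 2 ≤ n) {w : ℝ} (hw : w ≤ slp n 1) (i : ℕ) (hi : i + 2 ≤ n) :
    ((n : ℝ) - 1) * (slopeSeq n hn w i - slopeSeq n hn w (i + 1))
      ≤ (n - 1 - i) * (slp n 1 - w) := by
  induction i with
  | zero => simp [slopeSeq]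
  | succ i ih =>
    have ih := ih (by omega)
    have hanti := slopeSeq_antitone hn hw
    have h1 := conj_sub_le hn (hanti (Nat.le_succ i))
      (by simpa only [slopeSeq] using hanti (Nat.zero_le i))
    rw [slopeSeq_add_two]
    set k : ℝ := ((n - 2 - i : ℕ) : ℝ) with hk
    have hk' : (n : ℝ) = k + 2 + i := by
      rw [hk]; norm_cast; omega
    have hk0 : 0 ≤ k := by positivity
    have hn1 : 0 ≤ (n : ℝ) - 1 := by
      have : (2 : ℝ) ≤ n := by exact_mod_cast hn
      linarith
    simp only [Nat.succ_eq_add_one] at h1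
    have h2 := mul_le_mul_of_nonneg_left h1 (mul_nonneg hn1 (by positivity : 0 ≤ k / (k + 1)))
    have h3 := mul_le_mul_of_nonneg_left ih (by positivity : 0 ≤ k / (k + 1))
    have h4 : k / (k + 1) * ((n - 1 - i) * (slp n 1 - w)) = k * (slp n 1 - w) := by
      rw [hk']; field_simp; ring
    push_cast
    have h5 : ((n : ℝ) - 1 - (i + 1)) = k := by rw [hk']; ring
    rw [h5]
    linarith

/-- The weights (n-1-i)/(n-1) sum to n/2. Consequently a leftmost slope at most 1 forces w far below
`slp n 1`. -/
lemma slopeSeq_total_le {n : ℕ} (hn : 2 ≤ n) {w : ℝ} (hw : w ≤ slp n 1) :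
    slp n 1 - slopeSeq n hn w (n - 1) ≤ n / 2 * (slp n 1 - w) := by
  have key : ∀ m : ℕ, m + 1 ≤ n → ((n : ℝ) - 1) * (slp n 1 - slopeSeq n hn w m)
      ≤ m * (2 * n - 1 - m) / 2 * (slp n 1 - w) := by
    intro m
    induction m with
    | zero => simp [slopeSeq]
    | succ m ih =>
      intro hm
      have h1 := ih (by omega)
      have h2 := slopeSeq_sub_le hn hw m (by omega)
      push_cast
      nlinarith
  have h := key (n - 1) (by omega)
  have hn1 : 0 < (n : ℝ) - 1 := by
    have : (2 : ℝ) ≤ n := by exact_mod_cast hn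
    linarith
  rw [Nat.cast_sub (by omega), Nat.cast_one] at h
  refine le_of_mul_le_mul_left (h.trans (le_of_eq ?_)) hn1
  ring

/-- The values that the distribution function takes, from left to right, at a stationary point of
the objective with parameter `ε`. -/
structure IsChain (n : ℕ) (ε : ℝ) (u : ℕ → ℝ) : Prop where
  mono : Monotone u
  pos : 0 < u 0
  eq_one : u (n - 1) = 1
  lt_one : u (n - 2) < 1
  step : ∀ k : ℕ, k + 3 ≤ n → ((k : ℝ) + 1) * (icp n (u (k + 2)) - icp n (u (k + 1)))
    = (k + 2) * (slp n (u (k + 1)) - slp n (u k))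
  last : (1 + ε) * (n - 1) = slp n 1 - slp n (u (n - 2))

/-- A leftmost slope above 1 = `slp n 0` means that the leftmost tangency point is positive, hence
all are, and the artificial extension of `slp` is never used. -/
lemma isChain_of_slopeSeq {n : ℕ} (hn : 2 ≤ n) {w : ℝ} (hw : w < slp n 1)
    (h0 : 1 < slopeSeq n hn w (n - 1)) {ε : ℝ} (hε : (1 + ε) * (n - 1) = slp n 1 - w) :
    IsChain n ε (fun j => (slpIso n hn).symm (slopeSeq n hn w (n - 1 - j))) := by
  have hanti := slopeSeq_antitone hn hw.le
  have hmono : Monotone (fun j => (slpIso n hn).symm (slopeSeq n hn w (n - 1 - j))) :=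
    fun i j hij => (slpIso n hn).symm.monotone (hanti (by omega))
  have hpos : 0 < (slpIso n hn).symm (slopeSeq n hn w (n - 1)) := by
    have := (slpIso n hn).symm.strictMono h0
    rwa [← slp_zero (by omega : 1 ≤ n), slpIso_symm_slp hn le_rfl] at this
  have hpos' : ∀ j, 0 < (slpIso n hn).symm (slopeSeq n hn w (n - 1 - j)) := fun j =>
    hpos.trans_le (hmono (Nat.zero_le j))
  have hslp : ∀ j, slp n ((slpIso n hn).symm (slopeSeq n hn w (n - 1 - j)))
      = slopeSeq n hn w (n - 1 - j) := fun j => by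
    rw [← slpExt_of_nonneg (hpos' j).le, ← slpIso_apply hn, OrderIso.apply_symm_apply]
  have hicp : ∀ j, icp n ((slpIso n hn).symm (slopeSeq n hn w (n - 1 - j)))
      = conj n hn (slopeSeq n hn w (n - 1 - j)) := fun j => by
    rw [conj, max_eq_left (hpos' j).le]
  have e1 : n - 1 - (n - 2) = 1 := by omega
  refine ⟨hmono, hpos, ?_, ?_, fun k hk => ?_, ?_⟩
  · simp only [Nat.sub_self, slopeSeq]
    exact slpIso_symm_slp hn zero_le_one
  · rw [← slpIso_symm_slp hn zero_le_one]
    refine (slpIso n hn).symm.strictMono ?_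
    rw [e1]; simpa only [slopeSeq] using hw
  · simp only [hslp, hicp]
    obtain ⟨i, hi⟩ : ∃ i, n = k + 3 + i := ⟨n - (k + 3), by omega⟩
    have a0 : n - 1 - k = i + 2 := by omega
    have a1 : n - 1 - (k + 1) = i + 1 := by omega
    have a2 : n - 1 - (k + 2) = i := by omega
    have a3 : n - 2 - i = k + 1 := by omega
    rw [a0, a1, a2, slopeSeq_add_two, a3]
    push_cast
    field_simp
    ring
  · rw [hε, hslp, e1]; simp only [slopeSeq]

lemma exists_isChain {n : ℕ} (hn : 2 ≤ n) : ∃ e δ : ℝ, 0 < e ∧ 0 < δ ∧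
    (∃ u, IsChain n e u ∧ n * (1 + e) = icp n (u 0)) ∧
    ∀ ε ∈ Set.Icc e (e + δ), ∃ u, IsChain n ε u := by
  have hn' : (2 : ℝ) ≤ n := by exact_mod_cast hn
  have hn1 : 0 < (n : ℝ) - 1 := by linarith
  have h1le : (1 : ℝ) ≤ slp n 1 := by linarith [slp_ge hn zero_le_one]
  -- With (1 + ε)(n - 1) = slp n 1 - w, a zero of Φ is the equation n(1 + ε) = icp n (u 0).
  set Φ : ℝ → ℝ := fun w => (n - 1) * conj n hn (slopeSeq n hn w (n - 1)) - n * (slp n 1 - w)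
    with hΦ
  have hcont : Continuous Φ := by
    have h1 := continuous_slopeSeq hn (n - 1)
    have h2 := continuous_conj hn
    fun_prop
  have hneg : ∀ w, w ≤ slp n 1 → slopeSeq n hn w (n - 1) ≤ 1 → Φ w < 0 := by
    intro w hw hle
    have h1 := slopeSeq_total_le hn hw
    -- Slopes at most 1 are assigned the tangency point 0, whose intercept is n.
    have h2 : conj n hn (slopeSeq n hn w (n - 1)) = n := by
      rw [conj, max_eq_right, icp_zero]
      rw [← slpIso_symm_slp hn le_rfl, slp_zero (by omega)]
      exact (slpIso n hn).symm.monotone hle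
    simp only [hΦ, h2]
    have h3 := slp_one n
    nlinarith
  have hone : 0 < Φ (slp n 1) := by
    have h1 : ∀ i, slopeSeq n hn (slp n 1) i = slp n 1 := by
      intro i
      induction i using Nat.strong_induction_on with
      | _ i ih =>
        match i with
        | 0 => rfl
        | 1 => rfl
        | i + 2 =>
          rw [slopeSeq_add_two, ih i (by omega), ih (i + 1) (by omega)]; simp
    simp only [hΦ, h1, conj, slpIso_symm_slp hn zero_le_one]
    have h2 : 0 < icp n (max 1 0) := by
      rw [max_eq_left zero_le_one, icp_one]; linarith
    simp only [sub_self, mul_zero, sub_zero]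
    positivity
  have hlow : Φ 1 < 0 := hneg 1 h1le (by
    simpa only [slopeSeq] using slopeSeq_antitone hn h1le (by omega : 1 ≤ n - 1))
  obtain ⟨w, hwI, hw⟩ := intermediate_value_Icc h1le hcont.continuousOn
    (Set.mem_Icc.2 ⟨hlow.le, hone.le⟩)
  have hwlt : w < slp n 1 := lt_of_le_of_ne hwI.2 (by rintro rfl; linarith)
  have hb : 1 < slopeSeq n hn w (n - 1) := by
    by_contra hcon
    have := hneg w hwI.2 (not_lt.1 hcon)
    linarith
  have hchain := isChain_of_slopeSeq hn hwlt hb (ε := (slp n 1 - w) / (n - 1) - 1)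
    (by field_simp; ring)
  have hu0 : n * (1 + ((slp n 1 - w) / (n - 1) - 1))
      = icp n ((slpIso n hn).symm (slopeSeq n hn w (n - 1 - 0))) := by
    have h1 := hchain.pos
    have h2 : conj n hn (slopeSeq n hn w (n - 1))
        = icp n ((slpIso n hn).symm (slopeSeq n hn w (n - 1 - 0))) := by
      rw [Nat.sub_zero] at h1 ⊢; rw [conj, max_eq_left h1.le]
    rw [← h2]
    simp only [hΦ] at hw
    field_simp
    linarith
  -- A leftmost slope above 1 is an open condition on w; raising ε by at most δ lowers w by at most
  -- η/2.
  obtain ⟨η, hη, hball⟩ := Metric.isOpen_iff.1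
    (isOpen_lt continuous_const (continuous_slopeSeq hn (n - 1))) w hb
  refine ⟨(slp n 1 - w) / (n - 1) - 1, η / (2 * (n - 1)), ?_, by positivity,
    ⟨_, hchain, hu0⟩, fun ε hε => ⟨_, isChain_of_slopeSeq hn (w := slp n 1 - (1 + ε) * (n - 1))
      ?_ ?_ (by ring)⟩⟩
  · have h1 := icp_lt hn hchain.pos
    simp only [← hu0] at h1
    nlinarith
  · have : (slp n 1 - w) / (n - 1) ≤ 1 + ε := by linarith [hε.1]
    rw [div_le_iff₀ hn1] at this
    linarith
  · apply hball
    rw [Metric.mem_ball, Real.dist_eq, abs_lt]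
    have h1 : (slp n 1 - w) / (n - 1) ≤ 1 + ε := by linarith [hε.1]
    rw [div_le_iff₀ hn1] at h1
    have h2 : (1 + ε) ≤ (slp n 1 - w) / (n - 1) + η / (2 * (n - 1)) := by linarith [hε.2]
    have h3 : (slp n 1 - w) / (n - 1) + η / (2 * (n - 1)) = (slp n 1 - w + η / 2) / (n - 1) := by
      field_simp
    rw [h3, le_div_iff₀ hn1] at h2
    constructor <;> linarith

/-! ### Cancellation of the linear terms along a chain -/

/-- The expression `A n j y` as a function of the sequence of coordinates of `y`. -/
noncomputable def seqA (s : ℕ → ℝ) (j : ℕ) : ℝ :=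
  ((j : ℝ) + 2) / ((j : ℝ) + 1) * s (j + 1)
    - 1 / ((j : ℝ) * ((j : ℝ) + 1)) * ∑ ℓ ∈ Finset.Icc 1 j, s ℓ

lemma A_eq_seqA (n j : ℕ) (y : EuclideanSpace ℝ (Fin (n - 1))) : A n j y = seqA (coord n y) j := rfl

lemma IsChain.nonneg {n : ℕ} {ε : ℝ} {u : ℕ → ℝ} (h : IsChain n ε u) (j : ℕ) : 0 ≤ u j :=
  h.pos.le.trans (h.mono (Nat.zero_le j))

lemma IsChain.pos' {n : ℕ} {ε : ℝ} {u : ℕ → ℝ} (h : IsChain n ε u) (j : ℕ) : 0 < u j :=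
  h.pos.trans_le (h.mono (Nat.zero_le j))

/-- Summation by parts: `step` is the relation that lets the tangent contributions collapse to two
consecutive partial sums. -/
lemma IsChain.partial_sum {n : ℕ} {ε : ℝ} {u : ℕ → ℝ} (h : IsChain n ε u) (s : ℕ → ℝ) (m : ℕ)
    (hm : m + 2 ≤ n) :
    2 * slp n (u 0) * s 1
        - ∑ j ∈ Finset.Icc 1 m, (s j * icp n (u j) - slp n (u j) * seqA s j)
      = ((m : ℝ) + 2) / (m + 1) * slp n (u m) * ∑ j ∈ Finset.Icc 1 (m + 1), s j
        - icp n (u (m + 1)) * ∑ j ∈ Finset.Icc 1 m, s j := by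
  induction m with
  | zero => simp
  | succ m ih =>
    have ih := ih (by omega)
    have hs := h.step m (by omega)
    have h1 : ∑ j ∈ Finset.Icc 1 (m + 1 + 1), s j
        = ∑ j ∈ Finset.Icc 1 (m + 1), s j + s (m + 2) := Finset.sum_Icc_succ_top (by omega) _
    have h2 : ∑ j ∈ Finset.Icc 1 (m + 1), s j
        = ∑ j ∈ Finset.Icc 1 m, s j + s (m + 1) := Finset.sum_Icc_succ_top (by omega) _
    rw [Finset.sum_Icc_succ_top (by omega), ← sub_sub, ih, seqA, h1, h2]
    have e : icp n (u (m + 2)) = icp n (u (m + 1))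
        + (m + 2) * (slp n (u (m + 1)) - slp n (u m)) / (m + 1) := by
      field_simp; linarith
    rw [show m + 1 + 1 = m + 2 from rfl, e]
    push_cast
    field_simp
    ring

/-- After `partial_sum`, `eq_one` cancels the coefficient of the sum up to n - 2 and `last` that of
the sum up to n - 1. This identity serves the program, the bound for distributions and the extremal
laws alike. -/
lemma IsChain.total {n : ℕ} (hn : 2 ≤ n) {ε : ℝ} {u : ℕ → ℝ} (h : IsChain n ε u) (s : ℕ → ℝ) :
    (1 + ε) * n * ∑ j ∈ Finset.Icc 1 (n - 1), s j
      - (n : ℝ) * ((n : ℝ) + 1) / (2 * ((n : ℝ) - 1))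
        * ((n : ℝ) * ∑ j ∈ Finset.Icc 1 (n - 1), s j
          - ((n : ℝ) - 1) * ∑ j ∈ Finset.Icc 1 (n - 2), s j)
      + (2 * slp n (u 0) * s 1
        - ∑ j ∈ Finset.Icc 1 (n - 2), (s j * icp n (u j) - slp n (u j) * seqA s j)) = 0 := by
  obtain ⟨m, rfl⟩ : ∃ m, n = m + 2 := ⟨n - 2, by omega⟩
  have hl := h.last
  have h1 := h.eq_one
  simp only [Nat.add_sub_cancel, show m + 2 - 1 = m + 1 from rfl] at hl h1 ⊢
  rw [h.partial_sum s m le_rfl, h1, icp_one]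
  have h3 := slp_one (m + 2)
  have e : slp (m + 2) (u m) = slp (m + 2) 1 - (1 + ε) * (m + 1) := by
    push_cast at hl; linarith
  rw [e, h3]
  push_cast
  rw [show (m : ℝ) + 2 - 1 = m + 1 by ring]
  field_simp
  ring

/-! ### The stationary point -/

/-- The partial sums, with an initial term `1`, of the stationary point. -/
noncomputable def crit (u : ℕ → ℝ) : ℕ → ℝ
  | 0 => 0
  | 1 => 1
  | j + 2 => crit u (j + 1) + ((j : ℝ) + 1) / (j + 2)
      * (u j * (crit u (j + 1) - crit u j) + (crit u (j + 1) - 1) / (j * (j + 1)))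

/-- The coordinates of the stationary point. -/
noncomputable def critStep (u : ℕ → ℝ) (j : ℕ) : ℝ := crit u (j + 1) - crit u j

lemma crit_zero (u : ℕ → ℝ) : crit u 0 = 0 := by rw [crit]
lemma crit_one (u : ℕ → ℝ) : crit u 1 = 1 := by rw [crit]

lemma critStep_zero (u : ℕ → ℝ) : critStep u 0 = 1 := by simp [critStep, crit_zero, crit_one]

lemma critStep_succ (u : ℕ → ℝ) (j : ℕ) : critStep u (j + 1) = ((j : ℝ) + 1) / (j + 2)
      * (u j * critStep u j + (crit u (j + 1) - 1) / (j * (j + 1))) := by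
  rw [critStep, crit, critStep]; ring

lemma critStep_one (u : ℕ → ℝ) : critStep u 1 = u 0 / 2 := by
  -- At j = 0 the quotient in the recursion is 0/0, read as 0.
  rw [critStep_succ, critStep_zero]; simp; ring

lemma sum_critStep (u : ℕ → ℝ) (j : ℕ) :
    ∑ l ∈ Finset.Icc 1 j, critStep u l = crit u (j + 1) - 1 := by
  induction j with
  | zero => simp [crit_one]
  | succ j ih => rw [Finset.sum_Icc_succ_top (by omega), ih, critStep]; ring

lemma critStep_pos {u : ℕ → ℝ} (hu : ∀ j, 0 < u j) (j : ℕ) :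
    0 < critStep u j ∧ 1 ≤ crit u (j + 1) := by
  induction j with
  | zero => simp [critStep_zero, crit_one]
  | succ j ih =>
    have h1 := mul_pos (hu j) ih.1
    have h2 : 0 ≤ (crit u (j + 1) - 1) / ((j : ℝ) * (j + 1)) :=
      div_nonneg (by linarith [ih.2]) (by positivity)
    have h3 : 0 < critStep u (j + 1) := by rw [critStep_succ]; positivity
    refine ⟨h3, ?_⟩
    have : crit u (j + 1 + 1) = crit u (j + 1) + critStep u (j + 1) := by rw [critStep]; ring
    linarith [ih.2]

/-- The recursion of `crit` is this relation solved for the next coordinate. -/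
lemma seqA_critStep (u : ℕ → ℝ) {j : ℕ} (hj : 1 ≤ j) :
    seqA (critStep u) j = u j * critStep u j := by
  have : (0 : ℝ) < j := by exact_mod_cast hj
  rw [seqA, sum_critStep, critStep_succ]
  field_simp
  ring

/-- A sequence with the same first coordinate and the same ratios is the stationary one. -/
lemma eq_critStep {u s : ℕ → ℝ} {N : ℕ} (h1 : 2 * s 1 = u 0)
    (hA : ∀ j, 1 ≤ j → j ≤ N → seqA s j = u j * s j) :
    ∀ j, 1 ≤ j → j ≤ N + 1 → s j = critStep u j := by
  intro j
  induction j using Nat.strong_induction_on with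
  | _ j ih =>
    intro hj hjN
    obtain rfl | ⟨k, hk, rfl⟩ : j = 1 ∨ ∃ k, 1 ≤ k ∧ j = k + 1 := by
      rcases Nat.lt_or_ge 1 j with h | h
      · exact Or.inr ⟨j - 1, by omega, by omega⟩
      · exact Or.inl (by omega)
    · rw [critStep_one]; linarith
    · have e1 := hA k hk (by omega)
      have e2 := seqA_critStep u hk
      have e3 : ∑ l ∈ Finset.Icc 1 k, s l = ∑ l ∈ Finset.Icc 1 k, critStep u l :=
        Finset.sum_congr rfl fun l hl => by
          have := Finset.mem_Icc.1 hl
          exact ih l (by omega) this.1 (by omega)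
      rw [seqA, e3, ih k (by omega) hk (by omega), ← e2, seqA] at e1
      have hk' : (0 : ℝ) < k + 1 := by positivity
      have : ((k : ℝ) + 2) / (k + 1) * s (k + 1) = (k + 2) / (k + 1) * critStep u (k + 1) := by
        linarith
      exact mul_left_cancel₀ (by positivity) this

/-- The stationary point with ratios `u`. -/
noncomputable def critPt (n : ℕ) (u : ℕ → ℝ) : EuclideanSpace ℝ (Fin (n - 1)) :=
  WithLp.toLp 2 fun i => critStep u (i + 1)

lemma coord_critPt {n : ℕ} (u : ℕ → ℝ) {j : ℕ} (h1 : 1 ≤ j) (h2 : j ≤ n - 1) :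
    coord n (critPt n u) j = critStep u j := by
  rw [coord, dif_pos ⟨h1, h2⟩, critPt]
  simp only []
  congr 1
  omega

lemma A_critPt {n : ℕ} (u : ℕ → ℝ) {j : ℕ} (h1 : 1 ≤ j) (h2 : j ≤ n - 2) :
    A n j (critPt n u) = u j * critStep u j := by
  rw [← seqA_critStep u h1, A_eq_seqA, seqA, seqA, coord_critPt u (by omega) (by omega)]
  congr 2
  refine Finset.sum_congr rfl fun l hl => ?_
  have := Finset.mem_Icc.1 hl
  exact coord_critPt u this.1 (by omega)

lemma eq_of_coord {n : ℕ} {y z : EuclideanSpace ℝ (Fin (n - 1))}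
    (h : ∀ j, 1 ≤ j → j ≤ n - 1 → coord n y j = coord n z j) : y = z := by
  ext i
  have := h (i + 1) (by omega) (by omega)
  rw [coord, coord, dif_pos (by omega), dif_pos (by omega)] at this
  simpa using this

lemma coord_nonneg {n : ℕ} {y : EuclideanSpace ℝ (Fin (n - 1))} (hy : y ∈ K n) (j : ℕ) :
    0 ≤ coord n y j := by
  by_cases h : 1 ≤ j ∧ j ≤ n - 1
  · exact hy.1 j (Finset.mem_Icc.2 h)
  · simp [coord, h]

lemma critPt_mem_K {n : ℕ} {u : ℕ → ℝ} (hu : ∀ j, 0 < u j) : critPt n u ∈ K n := by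
  refine ⟨fun j hj => ?_, fun j hj => ?_⟩ <;> have := Finset.mem_Icc.1 hj
  · rw [coord_critPt u this.1 this.2]; exact (critStep_pos hu j).1.le
  · rw [A_critPt u this.1 this.2]; exact (mul_pos (hu j) (critStep_pos hu j).1).le

lemma critPt_mem_dom {n : ℕ} {u : ℕ → ℝ} (hu : ∀ j, 0 < u j) : critPt n u ∈ dom n := by
  intro j hj h0
  have := Finset.mem_Icc.1 hj
  rw [coord_critPt u this.1 (by omega)] at h0
  exact absurd h0 (critStep_pos hu j).1.ne'

/-! ### Minimality and uniqueness through tangency gaps -/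

/-- The tangent inequality for the perspective of `P n`. -/
lemma persp_le {n : ℕ} {a b v : ℝ} (ha : 0 ≤ a) (hb : 0 ≤ b) (hab : a = 0 → b = 0)
    (hv : 0 ≤ v) : a * P n (b / a) ≤ a * icp n v - slp n v * b := by
  rcases ha.eq_or_lt with rfl | ha
  · simp [hab rfl]
  · have := mul_le_mul_of_nonneg_left (P_le_tangent (n := n) (div_nonneg hb ha.le) hv) ha.le
    refine this.trans (le_of_eq ?_)
    field_simp

lemma persp_lt {n : ℕ} (hn : 2 ≤ n) {a b v : ℝ} (ha : 0 ≤ a) (hb : 0 ≤ b)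
    (hab : a = 0 → b = 0) (hv : 0 ≤ v) (hne : b ≠ v * a) :
    a * P n (b / a) < a * icp n v - slp n v * b := by
  rcases ha.eq_or_lt with rfl | ha
  · exact absurd (by simp [hab rfl]) hne
  · have := mul_lt_mul_of_pos_left (P_lt_tangent hn (div_nonneg hb ha.le) hv
      (by rwa [ne_eq, div_eq_iff ha.ne'])) ha
    refine this.trans_le (le_of_eq ?_)
    field_simp

/-- The objective minus its value at the stationary point, as a sum of tangency gaps. -/
lemma Upsilon_eq {n : ℕ} (hn : 2 ≤ n) {ε : ℝ} {u : ℕ → ℝ} (h : IsChain n ε u)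
    (z : EuclideanSpace ℝ (Fin (n - 1))) :
    Upsilon n ε z = ((1 + ε) * n - icp n (u 0))
      + (icp n (u 0) - slp n (u 0) * (2 * coord n z 1) - P n (2 * coord n z 1))
      + ∑ j ∈ Finset.Icc 1 (n - 2), (coord n z j * icp n (u j) - slp n (u j) * A n j z
          - coord n z j * P n (A n j z / coord n z j)) := by
  have h1 := h.total hn (coord n z)
  rw [Finset.sum_sub_distrib, Upsilon, L]
  simp only [A_eq_seqA]
  linarith

lemma Upsilon_critPt {n : ℕ} (hn : 2 ≤ n) {ε : ℝ} {u : ℕ → ℝ} (h : IsChain n ε u) :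
    Upsilon n ε (critPt n u) = (1 + ε) * n - icp n (u 0) := by
  rw [Upsilon_eq hn h, coord_critPt u le_rfl (by omega), critStep_one, Finset.sum_eq_zero, icp]
  · ring_nf
  · intro j hj
    have hj := Finset.mem_Icc.1 hj
    have hpos := (critStep_pos h.pos' j).1
    rw [coord_critPt u hj.1 (by omega), A_critPt u hj.1 hj.2, mul_div_assoc,
      div_self hpos.ne', icp]
    ring_nf

lemma gap_nonneg {n : ℕ} {ε : ℝ} {u : ℕ → ℝ} (h : IsChain n ε u)
    {z : EuclideanSpace ℝ (Fin (n - 1))} (hz : z ∈ K n) (hd : z ∈ dom n) {j : ℕ}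
    (hj : j ∈ Finset.Icc 1 (n - 2)) :
    0 ≤ coord n z j * icp n (u j) - slp n (u j) * A n j z
          - coord n z j * P n (A n j z / coord n z j) :=
  sub_nonneg.2 (persp_le (coord_nonneg hz j) (hz.2 j hj) (hd j hj) (h.nonneg j))

lemma le_Upsilon {n : ℕ} (hn : 2 ≤ n) {ε : ℝ} {u : ℕ → ℝ} (h : IsChain n ε u)
    {z : EuclideanSpace ℝ (Fin (n - 1))} (hz : z ∈ K n) (hd : z ∈ dom n) :
    Upsilon n ε (critPt n u) ≤ Upsilon n ε z := by
  rw [Upsilon_critPt hn h, Upsilon_eq hn h z]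
  have h1 := P_le_tangent (n := n) (mul_nonneg zero_le_two (coord_nonneg hz 1)) (h.nonneg 0)
  have h2 := Finset.sum_nonneg fun j hj => gap_nonneg h hz hd hj
  linarith

/-- Without strict inequality every gap vanishes; strict concavity then fixes 2y_1 and all ratios
A_j/y_j, and these determine the coordinates one after another. -/
lemma lt_Upsilon {n : ℕ} (hn : 2 ≤ n) {ε : ℝ} {u : ℕ → ℝ} (h : IsChain n ε u)
    {z : EuclideanSpace ℝ (Fin (n - 1))} (hz : z ∈ K n) (hd : z ∈ dom n)
    (hne : z ≠ critPt n u) : Upsilon n ε (critPt n u) < Upsilon n ε z := by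
  by_contra hcon
  rw [Upsilon_critPt hn h, Upsilon_eq hn h z] at hcon
  have h0 := mul_nonneg zero_le_two (coord_nonneg hz 1)
  have h1 := P_le_tangent (n := n) h0 (h.nonneg 0)
  have h2 : ∀ j ∈ Finset.Icc 1 (n - 2), _ := fun j hj => gap_nonneg h hz hd hj
  refine hne (eq_of_coord fun j hj1 hj2 => ?_)
  rw [coord_critPt u hj1 hj2]
  refine eq_critStep (N := n - 2) ?_ (fun k hk1 hk2 => ?_) j hj1 (by omega)
  · by_contra h3
    have := P_lt_tangent hn h0 (h.nonneg 0) h3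
    have := Finset.sum_nonneg h2
    linarith
  · by_contra h3
    have hk := Finset.mem_Icc.2 ⟨hk1, hk2⟩
    have h4 := persp_lt hn (coord_nonneg hz k) (hz.2 k hk) (hd k hk) (h.nonneg k) h3
    have := Finset.sum_pos' h2 ⟨k, hk, sub_pos.2 h4⟩
    linarith

lemma objective_lt {n : ℕ} (hn : 2 ≤ n) {ε : ℝ} {u : ℕ → ℝ} (h : IsChain n ε u)
    {z : EuclideanSpace ℝ (Fin (n - 1))} (hz : z ∈ K n) (hne : z ≠ critPt n u) :
    objective n ε (critPt n u) < objective n ε z := by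
  rw [objective, if_pos (critPt_mem_dom h.pos'), objective]
  split_ifs with hd
  · exact_mod_cast lt_Upsilon hn h hz hd hne
  · exact EReal.coe_lt_top _

/-! ### The gradient at the minimiser -/

lemma continuous_coord (n j : ℕ) : Continuous fun y => coord n y j := by
  unfold coord
  split_ifs <;> fun_prop

lemma continuous_A (n j : ℕ) : Continuous (A n j) := by
  have := continuous_coord n
  unfold A
  fun_prop

lemma differentiable_coord (n j : ℕ) : Differentiable ℝ fun y => coord n y j := by
  unfold coord
  split_ifs <;> fun_prop

lemma differentiable_P (n : ℕ) : Differentiable ℝ (P n) := by unfold P; fun_prop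

lemma differentiableAt_Upsilon {n : ℕ} {ε : ℝ} {y : EuclideanSpace ℝ (Fin (n - 1))}
    (hy : ∀ j ∈ Finset.Icc 1 (n - 2), coord n y j ≠ 0) : DifferentiableAt ℝ (Upsilon n ε) y := by
  have hc := differentiable_coord n
  have hP := differentiable_P n
  have hA : ∀ j, Differentiable ℝ (A n j) := fun j => by unfold A; fun_prop
  have hL : Differentiable ℝ (L n ε) := by unfold L; fun_prop
  unfold Upsilon
  refine (by fun_prop : DifferentiableAt ℝ (fun y => L n ε y - P n (2 * coord n y 1)) y).sub ?_
  refine DifferentiableAt.fun_sum fun j hj => ?_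
  have h1 : DifferentiableAt ℝ (fun y => A n j y / coord n y j) y := by
    simp only [div_eq_mul_inv]
    exact (hA j y).mul ((differentiableAt_inv (hy j hj)).comp y (hc j y))
  exact (hc j y).mul ((hP _).comp y h1)

/-- All y_j and A_j are positive here, so nearby points lie in K_n and the minimum is local.
Fermat's rule spares computing the derivative. -/
lemma hasGradientAt_critPt {n : ℕ} (hn : 2 ≤ n) {ε : ℝ} {u : ℕ → ℝ} (h : IsChain n ε u) :
    HasGradientAt (Upsilon n ε) 0 (critPt n u) := by
  have hpos : ∀ j ∈ Finset.Icc 1 (n - 1), 0 < coord n (critPt n u) j := fun j hj => by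
    have := Finset.mem_Icc.1 hj
    rw [coord_critPt u this.1 this.2]; exact (critStep_pos h.pos' j).1
  have hApos : ∀ j ∈ Finset.Icc 1 (n - 2), 0 < A n j (critPt n u) := fun j hj => by
    have := Finset.mem_Icc.1 hj
    rw [A_critPt u this.1 this.2]; exact mul_pos (h.pos' j) (critStep_pos h.pos' j).1
  have hsub : ∀ j ∈ Finset.Icc 1 (n - 2), j ∈ Finset.Icc 1 (n - 1) := fun j hj =>
    Finset.Icc_subset_Icc_right (by omega) hj
  have hdiff := differentiableAt_Upsilon (ε := ε) fun j hj => (hpos j (hsub j hj)).ne'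
  have hmin : IsLocalMin (Upsilon n ε) (critPt n u) := by
    have e1 := (Finset.eventually_all (Finset.Icc 1 (n - 1))).2 fun j hj =>
      (continuous_coord n j).continuousAt.eventually_const_lt (hpos j hj)
    have e2 := (Finset.eventually_all (Finset.Icc 1 (n - 2))).2 fun j hj =>
      (continuous_A n j).continuousAt.eventually_const_lt (hApos j hj)
    filter_upwards [e1, e2] with z h1 h2
    exact le_Upsilon hn h ⟨fun j hj => (h1 j hj).le, fun j hj => (h2 j hj).le⟩
      fun j hj h0 => absurd h0 (h1 j (hsub j hj)).ne'
  rw [hasGradientAt_iff_hasFDerivAt, map_zero]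
  have := hdiff.hasFDerivAt
  rwa [hmin.fderiv_eq_zero] at this

/-! ### Convexity, and uniqueness of the zero of the gradient -/

lemma coord_comb {n : ℕ} (x y : EuclideanSpace ℝ (Fin (n - 1))) (a b : ℝ) (j : ℕ) :
    coord n (a • x + b • y) j = a * coord n x j + b * coord n y j := by
  unfold coord
  split_ifs <;> simp

lemma sum_coord_comb {n : ℕ} (x y : EuclideanSpace ℝ (Fin (n - 1))) (a b : ℝ) (s : Finset ℕ) :
    ∑ j ∈ s, coord n (a • x + b • y) j = a * ∑ j ∈ s, coord n x j + b * ∑ j ∈ s, coord n y j := by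
  simp only [coord_comb, Finset.sum_add_distrib, Finset.mul_sum]

lemma A_comb {n : ℕ} (x y : EuclideanSpace ℝ (Fin (n - 1))) (a b : ℝ) (j : ℕ) :
    A n j (a • x + b • y) = a * A n j x + b * A n j y := by
  simp only [A, sum_coord_comb]
  rw [coord_comb]
  ring

lemma L_comb {n : ℕ} (ε : ℝ) (x y : EuclideanSpace ℝ (Fin (n - 1))) {a b : ℝ} (hab : a + b = 1) :
    L n ε (a • x + b • y) = a * L n ε x + b * L n ε y := by
  simp only [L, sum_coord_comb]
  linear_combination (-(1 + ε) * n) * hab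

lemma convex_K (n : ℕ) : Convex ℝ (K n) := by
  intro x hx y hy a b ha hb _
  refine ⟨fun j hj => ?_, fun j hj => ?_⟩
  · rw [coord_comb]
    exact add_nonneg (mul_nonneg ha (hx.1 j hj)) (mul_nonneg hb (hy.1 j hj))
  · rw [A_comb]
    exact add_nonneg (mul_nonneg ha (hx.2 j hj)) (mul_nonneg hb (hy.2 j hj))

lemma convex_K_inter_dom (n : ℕ) : Convex ℝ (K n ∩ dom n) := by
  rw [convex_iff_forall_pos]
  intro x hx y hy a b ha hb hab
  refine ⟨convex_K n hx.1 hy.1 ha.le hb.le hab, fun j hj h0 => ?_⟩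
  have h1 := mul_nonneg ha.le (coord_nonneg hx.1 j)
  have h2 := mul_nonneg hb.le (coord_nonneg hy.1 j)
  rw [coord_comb] at h0
  have h3 : a * coord n x j = 0 := by linarith
  have h4 : b * coord n y j = 0 := by linarith
  rw [A_comb, hx.2 j hj ((mul_eq_zero.1 h3).resolve_left ha.ne'),
    hy.2 j hj ((mul_eq_zero.1 h4).resolve_left hb.ne')]
  simp

/-- Both terms are bounded by the tangent at the ratio v of the combination, where that tangent is
exact. -/
lemma persp_concave {n : ℕ} {a b x₁ x₂ A₁ A₂ : ℝ} (ha : 0 < a) (hb : 0 < b)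
    (hx₁ : 0 ≤ x₁) (hx₂ : 0 ≤ x₂) (hA₁ : 0 ≤ A₁) (hA₂ : 0 ≤ A₂)
    (h₁ : x₁ = 0 → A₁ = 0) (h₂ : x₂ = 0 → A₂ = 0) :
    a * (x₁ * P n (A₁ / x₁)) + b * (x₂ * P n (A₂ / x₂))
      ≤ (a * x₁ + b * x₂) * P n ((a * A₁ + b * A₂) / (a * x₁ + b * x₂)) := by
  have hm : 0 ≤ a * x₁ + b * x₂ := by positivity
  have hM : 0 ≤ a * A₁ + b * A₂ := by positivity
  set v := (a * A₁ + b * A₂) / (a * x₁ + b * x₂) with hv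
  have hv0 : 0 ≤ v := div_nonneg hM hm
  have e1 := mul_le_mul_of_nonneg_left (persp_le (n := n) hx₁ hA₁ h₁ hv0) ha.le
  have e2 := mul_le_mul_of_nonneg_left (persp_le (n := n) hx₂ hA₂ h₂ hv0) hb.le
  have e3 : (a * x₁ + b * x₂) * v = a * A₁ + b * A₂ := by
    rcases hm.eq_or_lt with h0 | h0
    · have h3 : 0 ≤ a * x₁ := by positivity
      have h4 : 0 ≤ b * x₂ := by positivity
      have h5 : a * x₁ = 0 := by linarith
      have h6 : b * x₂ = 0 := by linarith
      rw [← h0, h₁ ((mul_eq_zero.1 h5).resolve_left ha.ne'),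
        h₂ ((mul_eq_zero.1 h6).resolve_left hb.ne')]
      simp
    · rw [hv]; field_simp
  have e4 : icp n v = P n v + v * slp n v := rfl
  have e5 : (a * x₁ + b * x₂) * P n v
      = (a * x₁ + b * x₂) * icp n v - slp n v * (a * A₁ + b * A₂) := by
    rw [e4, ← e3]; ring
  rw [e5]
  linarith

lemma convexOn_Upsilon (n : ℕ) (ε : ℝ) : ConvexOn ℝ (K n ∩ dom n) (Upsilon n ε) := by
  rw [convexOn_iff_forall_pos]
  refine ⟨convex_K_inter_dom n, fun x hx y hy a b ha hb hab => ?_⟩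
  -- With both denominators 1 this is concavity of `P n` itself.
  have h0 := persp_concave (n := n) ha hb zero_le_one zero_le_one
    (mul_nonneg zero_le_two (coord_nonneg hx.1 1)) (mul_nonneg zero_le_two (coord_nonneg hy.1 1))
    (by simp) (by simp)
  simp only [mul_one, div_one, one_mul, hab] at h0
  have h1 := Finset.sum_le_sum fun j (hj : j ∈ Finset.Icc 1 (n - 2)) =>
    persp_concave (n := n) ha hb (coord_nonneg hx.1 j) (coord_nonneg hy.1 j)
      (hx.1.2 j hj) (hy.1.2 j hj) (hx.2 j hj) (hy.2 j hj)
  rw [Finset.sum_add_distrib, ← Finset.mul_sum, ← Finset.mul_sum] at h1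
  simp only [Upsilon, smul_eq_mul, L_comb ε x y hab, coord_comb, A_comb]
  rw [show 2 * (a * coord n x 1 + b * coord n y 1)
    = a * (2 * coord n x 1) + b * (2 * coord n y 1) by ring]
  linarith

lemma exists_slp_gt {n : ℕ} (hn : 2 ≤ n) (c : ℝ) : ∃ v, 0 ≤ v ∧ c < slp n v := by
  refine ⟨|c|, abs_nonneg c, ?_⟩
  have := slp_ge hn (abs_nonneg c)
  linarith [le_abs_self c, abs_nonneg c]

lemma eq_critPt_of_hasGradientAt {n : ℕ} (hn : 2 ≤ n) {ε : ℝ} {u : ℕ → ℝ} (h : IsChain n ε u)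
    {z : EuclideanSpace ℝ (Fin (n - 1))} (hz : z ∈ K n) (hg : HasGradientAt (Upsilon n ε) 0 z) :
    z = critPt n u := by
  by_contra hne
  set y := critPt n u with hy
  have hyK : y ∈ K n := critPt_mem_K h.pos'
  have hline : ∀ s : ℝ, z + s • (y - z) = (1 - s) • z + s • y := fun s => by module
  have hder : HasDerivAt (fun s : ℝ => Upsilon n ε (z + s • (y - z))) 0 0 := by
    rw [hasGradientAt_iff_hasFDerivAt, map_zero] at hg
    have := hg.hasLineDerivAt (y - z)
    rwa [HasLineDerivAt, zero_apply] at this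
  have hpos : ∀ s ∈ Set.Ioo (0 : ℝ) 1, ∀ j ∈ Finset.Icc 1 (n - 2),
      0 < coord n (z + s • (y - z)) j := fun s hs j hj => by
    have := Finset.mem_Icc.1 hj
    rw [hline, coord_comb, hy, coord_critPt u this.1 (by omega)]
    have h1 := mul_pos hs.1 (critStep_pos h.pos' j).1
    have h2 := mul_nonneg (sub_nonneg.2 hs.2.le) (coord_nonneg hz j)
    linarith
  have hK : ∀ s ∈ Set.Ioo (0 : ℝ) 1, z + s • (y - z) ∈ K n := fun s hs => by
    rw [hline]
    exact convex_K n hz hyK (sub_nonneg.2 hs.2.le) hs.1.le (by ring)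
  have hIoo : Set.Ioo (0 : ℝ) 1 ∈ nhdsWithin 0 (Set.Ioi 0) := Ioo_mem_nhdsGT zero_lt_one
  by_cases hd : z ∈ dom n
  -- By convexity the difference quotients towards y are at most Υ(y) - Υ(z) < 0, yet they tend to
  -- 0.
  · have hlt := lt_Upsilon hn h hz hd hne
    have hlim := hder.tendsto_slope_zero_right
    have : (0 : ℝ) ≤ Upsilon n ε y - Upsilon n ε z := by
      refine le_of_tendsto hlim ?_
      filter_upwards [hIoo] with s hs
      have h1 := (convexOn_Upsilon n ε).2 ⟨hz, hd⟩ ⟨hyK, critPt_mem_dom h.pos'⟩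
        (sub_nonneg.2 hs.2.le) hs.1.le (by ring)
      rw [zero_add, hline, zero_smul, add_zero, smul_eq_mul, inv_mul_le_iff₀ hs.1]
      simp only [smul_eq_mul] at h1
      linarith
    linarith
  -- Outside `dom` the formula is finite only through division by zero. On the segment towards y,
  -- the tangent at any v bounds it below; in the limit the bound grows without limit in `slp n v`,
  -- contradicting continuity at z.
  · obtain ⟨j, hj, hj0, hA⟩ : ∃ j ∈ Finset.Icc 1 (n - 2), coord n z j = 0 ∧ A n j z ≠ 0 := by
      simpa [dom, and_assoc] using hd
    have hApos : 0 < A n j z := lt_of_le_of_ne (hz.2 j hj) hA.symm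
    have key : ∀ v, 0 ≤ v → (1 + ε) * n - icp n (u 0) + (slp n v - slp n (u j)) * A n j z
        ≤ Upsilon n ε z := by
      intro v hv
      have hlim : Filter.Tendsto (fun s : ℝ => Upsilon n ε (z + s • (y - z)))
          (nhdsWithin 0 (Set.Ioi 0)) (nhds (Upsilon n ε z)) := by
        have := hder.continuousAt.tendsto.mono_left (nhdsWithin_le_nhds (s := Set.Ioi 0))
        simpa using this
      have hpath : Continuous fun s : ℝ => z + s • (y - z) := by fun_prop
      have hc : Continuous fun s : ℝ => (1 + ε) * n - icp n (u 0)
          + (coord n (z + s • (y - z)) j * (icp n (u j) - icp n v)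
            + (slp n v - slp n (u j)) * A n j (z + s • (y - z))) := by
        have h1 := (continuous_coord n j).comp hpath
        have h2 := (continuous_A n j).comp hpath
        simp only [Function.comp_def] at h1 h2
        fun_prop
      have hlim2 := hc.continuousAt.tendsto.mono_left
        (nhdsWithin_le_nhds (a := (0 : ℝ)) (s := Set.Ioi 0))
      have := le_of_tendsto_of_tendsto hlim2 hlim ?_
      · simpa [hj0] using this
      · filter_upwards [hIoo] with s hs
        have hsd : z + s • (y - z) ∈ dom n := fun i hi h0 => absurd h0 (hpos s hs i hi).ne'
        have h1 := P_le_tangent (n := n) (mul_nonneg zero_le_two (coord_nonneg (hK s hs) 1))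
          (h.nonneg 0)
        have h2 := persp_le (n := n) (hpos s hs j hj).le ((hK s hs).2 j hj) (hsd j hj) hv
        have h3 := Finset.single_le_sum (fun i hi => gap_nonneg h (hK s hs) hsd hi) hj
        rw [Upsilon_eq hn h]
        linarith
    obtain ⟨v, hv, hlt⟩ := exists_slp_gt hn
      ((Upsilon n ε z - ((1 + ε) * n - icp n (u 0))) / A n j z + slp n (u j))
    have h1 := key v hv
    have h2 : (Upsilon n ε z - ((1 + ε) * n - icp n (u 0))) / A n j z < slp n v - slp n (u j) := by
      linarith
    rw [div_lt_iff₀ hApos] at h2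
    linarith

/-! ### Dependence of the optimal value on ε -/

lemma Upsilon_sub {n : ℕ} (e ε : ℝ) (y : EuclideanSpace ℝ (Fin (n - 1))) :
    Upsilon n ε y = Upsilon n e y
      + (ε - e) * (n * (1 + ∑ j ∈ Finset.Icc 1 (n - 1), coord n y j)) := by
  simp only [Upsilon, L]; ring

lemma optValue_nonneg {n : ℕ} (hn : 2 ≤ n) {e : ℝ} {u : ℕ → ℝ} (h : IsChain n e u)
    (h0 : n * (1 + e) = icp n (u 0)) {ε : ℝ} (hε : e ≤ ε) : 0 ≤ optValue n ε := by
  refine le_iInf₂ fun y hy => ?_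
  rw [objective]
  split_ifs with hd
  · have h1 := le_Upsilon hn h hy hd
    rw [Upsilon_critPt hn h] at h1
    have h2 : 0 ≤ (ε - e) * (n * (1 + ∑ j ∈ Finset.Icc 1 (n - 1), coord n y j)) := by
      have := Finset.sum_nonneg fun j (_ : j ∈ Finset.Icc 1 (n - 1)) => coord_nonneg hy j
      have := sub_nonneg.2 hε
      positivity
    have h3 : 0 ≤ Upsilon n ε y := by rw [Upsilon_sub e ε]; linarith
    exact_mod_cast h3
  · exact le_top

/-- The minimiser for e has value 0 there, and the coefficient of ε is positive on K_n, so this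
point is a negative witness for every ε < e. -/
lemma le_of_optValue_nonneg {n : ℕ} (hn : 2 ≤ n) {e : ℝ} {u : ℕ → ℝ} (h : IsChain n e u)
    (h0 : n * (1 + e) = icp n (u 0)) {ε : ℝ} (hε : 0 ≤ optValue n ε) : e ≤ ε := by
  by_contra hlt
  have hK : critPt n u ∈ K n := critPt_mem_K h.pos'
  have h1 : 0 ≤ objective n ε (critPt n u) := hε.trans (iInf₂_le _ hK)
  rw [objective, if_pos (critPt_mem_dom h.pos'), Upsilon_sub e ε, Upsilon_critPt hn h] at h1
  have h2 := EReal.coe_nonneg.1 h1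
  have h3 := Finset.sum_nonneg fun j (_ : j ∈ Finset.Icc 1 (n - 1)) => coord_nonneg hK j
  have h4 : (0 : ℝ) < n := by exact_mod_cast (by omega : 0 < n)
  have h5 : 0 < (e - ε) * (n * (1 + ∑ j ∈ Finset.Icc 1 (n - 1), coord n (critPt n u) j)) :=
    mul_pos (by linarith) (by positivity)
  linarith

/-! ### Mean excess, thresholds and integrals of the distribution function -/

lemma integrable_sup' {α ι : Type*} [MeasurableSpace α] {μ : Measure α} {s : Finset ι}
    (hs : s.Nonempty) {f : ι → α → ℝ} (hf : ∀ i ∈ s, Integrable (f i) μ) :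
    Integrable (fun a => s.sup' hs fun i => f i a) μ := by
  have h : Integrable (s.sup' hs f) μ :=
    Finset.sup'_induction hs f (p := fun g => Integrable g μ)
      (fun _ h₁ _ h₂ => Integrable.sup h₁ h₂) hf
  convert h using 2 with a
  rw [Finset.sup'_apply]

lemma P_eq_sum_range (n : ℕ) (t : ℝ) : P n t = ∑ l ∈ Finset.range n, (1 - t ^ (l + 1)) := by
  have h : ∀ m : ℕ, ∑ l ∈ Finset.Icc 1 m, t ^ l = ∑ l ∈ Finset.range m, t ^ (l + 1) := by
    intro m
    induction m with
    | zero => simp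
    | succ m ih => rw [Finset.sum_Icc_succ_top (by omega), Finset.sum_range_succ, ih]
  rw [P, h]
  simp [Finset.sum_sub_distrib]

lemma one_sub_pow_le {t : ℝ} (ht : 0 ≤ t) (k : ℕ) : 1 - t ^ (k + 1) ≤ (k + 1) * (1 - t) := by
  have := pow_tangent ht zero_le_one k
  simp only [one_pow] at this
  linarith

lemma one_sub_le_P {n : ℕ} (hn : 1 ≤ n) {t : ℝ} (ht : 0 ≤ t) (ht1 : t ≤ 1) : 1 - t ≤ P n t := by
  rw [P_eq_sum_range]
  have := Finset.single_le_sum (f := fun l => 1 - t ^ (l + 1))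
    (fun l _ => sub_nonneg.2 (pow_le_one₀ ht ht1)) (Finset.mem_range.2 hn)
  simpa using this

/-- The mean excess of a distribution over the level `a`. -/
noncomputable def psi (μ : Measure ℝ) (a : ℝ) : ℝ := ∫ x, max (x - a) 0 ∂μ

section

variable {μ : Measure ℝ}

lemma measurable_cdf : Measurable fun x => cdf μ x := (monotone_cdf μ).measurable

lemma psi_nonneg (a : ℝ) : 0 ≤ psi μ a := integral_nonneg fun _ => le_max_right _ _

lemma ae_nonneg (h0 : μ (Set.Iio 0) = 0) : ∀ᵐ x ∂μ, 0 ≤ x := by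
  rw [ae_iff]
  simpa [Set.Iio] using h0

/-- The thresholds of the optimal policy: `m * thr μ m` is its value with `m` periods to go. -/
noncomputable def thr (μ : Measure ℝ) : ℕ → ℝ
  | 0 => 0
  | m + 1 => ((∫ x, x ∂μ) + m * (thr μ m + psi μ (thr μ m))) / (m + 1)

lemma thr_zero : thr μ 0 = 0 := by rw [thr]

lemma psi_zero (h0 : μ (Set.Iio 0) = 0) : psi μ 0 = ∫ x, x ∂μ := by
  refine integral_congr_ae ?_
  filter_upwards [ae_nonneg h0] with x hx
  simp [hx]

lemma succ_mul_thr_succ (m : ℕ) :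
    ((m : ℝ) + 1) * thr μ (m + 1) = (∫ x, x ∂μ) + m * thr μ m + m * psi μ (thr μ m) := by
  rw [thr]; field_simp; ring

lemma thr_one : thr μ 1 = ∫ x, x ∂μ := by
  have := succ_mul_thr_succ (μ := μ) 0
  simpa using this

lemma sum_thr_sub (m : ℕ) :
    ∑ j ∈ Finset.Icc 1 m, (thr μ (j + 1) - thr μ j) = thr μ (m + 1) - ∫ x, x ∂μ := by
  induction m with
  | zero => simp [thr_one]
  | succ m ih => rw [Finset.sum_Icc_succ_top (by omega), ih]; ring

/-- Both excesses are eliminated by the recursion. For ordered thresholds the right side is the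
integral of the distribution function between them, by `psi_sub_psi`. -/
lemma seqA_thr {j : ℕ} (hj : 1 ≤ j) : seqA (fun j => thr μ (j + 1) - thr μ j) j
    = thr μ (j + 1) - thr μ j - psi μ (thr μ j) + psi μ (thr μ (j + 1)) := by
  have h1 := succ_mul_thr_succ (μ := μ) j
  have h2 := succ_mul_thr_succ (μ := μ) (j + 1)
  have hj' : (0 : ℝ) < j := by exact_mod_cast hj
  rw [seqA, sum_thr_sub]
  push_cast at h2
  have e1 : psi μ (thr μ j) = (((j : ℝ) + 1) * thr μ (j + 1) - (∫ x, x ∂μ) - j * thr μ j) / j := by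
    field_simp; linarith
  have e2 : psi μ (thr μ (j + 1)) = (((j : ℝ) + 1 + 1) * thr μ (j + 1 + 1) - (∫ x, x ∂μ)
      - (j + 1) * thr μ (j + 1)) / (j + 1) := by
    field_simp; linarith
  rw [e1, e2]
  field_simp
  ring

variable [IsProbabilityMeasure μ]

lemma real_Ioi (t : ℝ) : μ.real (Set.Ioi t) = 1 - cdf μ t := by
  rw [cdf_eq_real, ← Set.compl_Iic, probReal_compl_eq_one_sub measurableSet_Iic]

lemma integrable_max_sub (hi : Integrable (fun x : ℝ => x) μ) (a : ℝ) :
    Integrable (fun x => max (x - a) 0) μ :=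
  (hi.sub (integrable_const a)).sup (integrable_const 0)

lemma integrableOn_one_sub_cdf (hi : Integrable (fun x : ℝ => x) μ) (a : ℝ) :
    IntegrableOn (fun x => 1 - cdf μ x) (Set.Ioi a) := by
  have h1 := lintegral_eq_lintegral_meas_lt μ (f := fun x => max (x - a) 0)
    (Filter.Eventually.of_forall fun x => le_max_right _ _) (integrable_max_sub hi a).aemeasurable
  have h2 : ∀ t ∈ Set.Ioi (0 : ℝ), μ {x | t < max (x - a) 0}
      = ENNReal.ofReal (1 - cdf μ (a + t)) := by
    intro t ht
    rw [← real_Ioi, ofReal_measureReal]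
    congr 1
    ext x
    simp only [Set.mem_ofPred_eq, Set.mem_Ioi, lt_max_iff]
    constructor
    · rintro (h | h)
      · linarith
      · exact absurd h (not_lt.2 (le_of_lt ht))
    · intro h; left; linarith
  rw [setLIntegral_congr_fun measurableSet_Ioi h2] at h1
  have h3 := (measurePreserving_add_left volume a).setLIntegral_comp_preimage_emb
    (measurableEmbedding_addLeft a) (fun x => ENNReal.ofReal (1 - cdf μ x)) (Set.Ioi a)
  rw [show (fun x => a + x) ⁻¹' Set.Ioi a = Set.Ioi 0 by ext; simp] at h3
  refine ⟨(measurable_const.sub measurable_cdf).aestronglyMeasurable, ?_⟩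
  rw [hasFiniteIntegral_iff_ofReal
    (Filter.Eventually.of_forall fun x => sub_nonneg.2 (cdf_le_one μ x)), ← h3, ← h1]
  exact (integrable_max_sub hi a).lintegral_lt_top

lemma psi_eq_integral (hi : Integrable (fun x : ℝ => x) μ) (a : ℝ) :
    psi μ a = ∫ x in Set.Ioi a, (1 - cdf μ x) := by
  have h1 := (integrable_max_sub hi a).integral_eq_integral_meas_lt
    (Filter.Eventually.of_forall fun x => le_max_right _ _)
  have h2 : ∀ t ∈ Set.Ioi (0 : ℝ), μ.real {x | t < max (x - a) 0} = 1 - cdf μ (a + t) := by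
    intro t ht
    rw [← real_Ioi]
    congr 1
    ext x
    simp only [Set.mem_ofPred_eq, Set.mem_Ioi, lt_max_iff]
    constructor
    · rintro (h | h)
      · linarith
      · exact absurd h (not_lt.2 (le_of_lt ht))
    · intro h; left; linarith
  rw [setIntegral_congr_fun measurableSet_Ioi h2] at h1
  have h3 := (measurePreserving_add_left volume a).setIntegral_preimage_emb
    (measurableEmbedding_addLeft a) (fun x => 1 - cdf μ x) (Set.Ioi a)
  rw [show (fun x => a + x) ⁻¹' Set.Ioi a = Set.Ioi 0 by ext; simp] at h3
  rw [psi, h1, h3]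

lemma psi_sub_psi (hi : Integrable (fun x : ℝ => x) μ) {a b : ℝ} (hab : a ≤ b) :
    psi μ a - psi μ b = ∫ x in Set.Ioc a b, (1 - cdf μ x) := by
  have h := integrableOn_one_sub_cdf hi a
  rw [psi_eq_integral hi, psi_eq_integral hi, ← Set.Ioc_union_Ioi_eq_Ioi hab,
    setIntegral_union (Set.Ioc_disjoint_Ioi le_rfl) measurableSet_Ioi
      (h.mono_set Set.Ioc_subset_Ioi_self) (h.mono_set (Set.Ioi_subset_Ioi hab))]
  ring

lemma psi_sub_psi_le (hi : Integrable (fun x : ℝ => x) μ) {a b : ℝ} (hab : a ≤ b) :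
    psi μ a - psi μ b ≤ b - a := by
  have h1 : psi μ a ≤ ∫ x, (max (x - b) 0 + (b - a)) ∂μ := by
    refine integral_mono (integrable_max_sub hi a)
      ((integrable_max_sub hi b).add (integrable_const _)) fun x => ?_
    refine max_le ?_ ?_
    · linarith [le_max_left (x - b) 0]
    · linarith [le_max_right (x - b) 0]
  rw [integral_add (integrable_max_sub hi b) (integrable_const _)] at h1
  simp only [integral_const, probReal_univ, one_smul] at h1
  have : psi μ b = ∫ x, max (x - b) 0 ∂μ := rfl
  linarith

lemma integrableOn_one_sub_cdf_pow (hi : Integrable (fun x : ℝ => x) μ) (k : ℕ) (a : ℝ) :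
    IntegrableOn (fun x => 1 - cdf μ x ^ (k + 1)) (Set.Ioi a) := by
  refine Integrable.mono' ((integrableOn_one_sub_cdf hi a).const_mul ((k : ℝ) + 1))
    (measurable_const.sub (measurable_cdf.pow_const _)).aestronglyMeasurable
    (Filter.Eventually.of_forall fun x => ?_)
  rw [Real.norm_of_nonneg (sub_nonneg.2 (pow_le_one₀ (cdf_nonneg μ x) (cdf_le_one μ x)))]
  exact one_sub_pow_le (cdf_nonneg μ x) k

lemma integral_max_pi (h0 : μ (Set.Iio 0) = 0) (hi : Integrable (fun x : ℝ => x) μ) (k : ℕ) :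
    ∫ x : Fin (k + 1) → ℝ, Finset.univ.sup' Finset.univ_nonempty x
      ∂(Measure.pi fun _ : Fin (k + 1) => μ) = ∫ x in Set.Ioi 0, (1 - cdf μ x ^ (k + 1)) := by
  have hev : ∀ i : Fin (k + 1), MeasurePreserving (Function.eval i)
      (Measure.pi fun _ : Fin (k + 1) => μ) μ := fun i =>
    measurePreserving_eval (fun _ : Fin (k + 1) => μ) i
  have hint : Integrable (fun x : Fin (k + 1) → ℝ => Finset.univ.sup' Finset.univ_nonempty x)
      (Measure.pi fun _ : Fin (k + 1) => μ) :=
    integrable_sup' (f := fun i (x : Fin (k + 1) → ℝ) => x i) Finset.univ_nonempty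
      fun i _ => (hev i).integrable_comp_of_integrable hi
  have hnn : ∀ᵐ x ∂(Measure.pi fun _ : Fin (k + 1) => μ),
      (0 : ℝ) ≤ Finset.univ.sup' Finset.univ_nonempty x := by
    filter_upwards [(hev 0).quasiMeasurePreserving.ae (ae_nonneg h0)] with x hx
    exact le_trans hx (Finset.le_sup' x (Finset.mem_univ 0))
  rw [hint.integral_eq_integral_meas_lt hnn]
  refine setIntegral_congr_fun measurableSet_Ioi fun t _ => ?_
  have hset : {x : Fin (k + 1) → ℝ | t < Finset.univ.sup' Finset.univ_nonempty x}
      = (Set.univ.pi fun _ => Set.Iic t)ᶜ := by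
    ext x
    simp [Finset.lt_sup'_iff, Pi.le_def]
  simp only [hset]
  rw [probReal_compl_eq_one_sub (MeasurableSet.univ_pi fun _ => measurableSet_Iic),
    measureReal_def, Measure.pi_pi, ENNReal.toReal_prod, cdf_eq_real]
  simp [measureReal_def]

lemma integrableOn_P_cdf (hi : Integrable (fun x : ℝ => x) μ) (n : ℕ) (a : ℝ) :
    IntegrableOn (fun x => P n (cdf μ x)) (Set.Ioi a) := by
  simp only [P_eq_sum_range]
  exact integrable_finsetSum _ fun l _ => integrableOn_one_sub_cdf_pow hi l a

/-- A bound on the integral of `P n ∘ cdf` over an interval, from a tangent line to `P n`. -/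
lemma setIntegral_P_cdf_le (hi : Integrable (fun x : ℝ => x) μ) (n : ℕ) {a b v : ℝ}
    (hab : a ≤ b) (hv : 0 ≤ v) : ∫ x in Set.Ioc a b, P n (cdf μ x)
      ≤ (b - a) * icp n v - slp n v * ((b - a) - psi μ a + psi μ b) := by
  have h1 : IntegrableOn (fun x => 1 - cdf μ x) (Set.Ioc a b) :=
    (integrableOn_one_sub_cdf hi a).mono_set Set.Ioc_subset_Ioi_self
  have h2 : IntegrableOn (fun _ : ℝ => icp n v - slp n v) (Set.Ioc a b) :=
    integrableOn_const measure_Ioc_lt_top.ne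
  calc ∫ x in Set.Ioc a b, P n (cdf μ x)
      ≤ ∫ x in Set.Ioc a b, ((icp n v - slp n v) + slp n v * (1 - cdf μ x)) := by
        refine setIntegral_mono ((integrableOn_P_cdf hi n a).mono_set Set.Ioc_subset_Ioi_self)
          (h2.add (h1.const_mul _)) fun x => ?_
        have := P_le_tangent (n := n) (cdf_nonneg μ x) hv
        simp only
        linarith
    _ = _ := by
        rw [integral_add h2 (h1.const_mul _), setIntegral_const, integral_const_mul,
          ← psi_sub_psi hi hab]
        simp [hab]
        ring

lemma setIntegral_Ioi_P_cdf_le (hi : Integrable (fun x : ℝ => x) μ) (n : ℕ) (a : ℝ) :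
    ∫ x in Set.Ioi a, P n (cdf μ x) ≤ slp n 1 * psi μ a := by
  rw [psi_eq_integral hi, ← integral_const_mul]
  refine setIntegral_mono (integrableOn_P_cdf hi n a)
    ((integrableOn_one_sub_cdf hi a).const_mul _) fun x => ?_
  have := P_le_tangent (n := n) (cdf_nonneg μ x) zero_le_one
  rw [icp_one] at this
  simp only
  linarith

lemma integral_Ioi_eq_sum {g : ℝ → ℝ} {t : ℕ → ℝ} (ht : Monotone t)
    (hg : IntegrableOn g (Set.Ioi (t 0))) (N : ℕ) :
    ∫ x in Set.Ioi (t 0), g x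
      = (∑ j ∈ Finset.range N, ∫ x in Set.Ioc (t j) (t (j + 1)), g x)
        + ∫ x in Set.Ioi (t N), g x := by
  induction N with
  | zero => simp
  | succ N ih =>
    have h := hg.mono_set (Set.Ioi_subset_Ioi (ht (Nat.zero_le N)))
    rw [ih, Finset.sum_range_succ, ← Set.Ioc_union_Ioi_eq_Ioi (ht (Nat.le_succ N)),
      setIntegral_union (Set.Ioc_disjoint_Ioi le_rfl) measurableSet_Ioi
        (h.mono_set Set.Ioc_subset_Ioi_self) (h.mono_set (Set.Ioi_subset_Ioi (ht (Nat.le_succ N))))]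
    ring

/-- The two arguments of the maximum are the payoffs of keeping x for one period and for all m + 1
periods, when m periods are worth m t. -/
lemma integral_max_affine (hi : Integrable (fun x : ℝ => x) μ) (m : ℕ) (t : ℝ) :
    ∫ x, max (x + m * t) ((m + 1) * x) ∂μ = (∫ x, x ∂μ) + m * t + m * psi μ t := by
  have h : ∀ x : ℝ, max (x + m * t) ((m + 1) * x) = x + m * t + m * max (x - t) 0 := by
    intro x
    rw [mul_max_of_nonneg _ _ (Nat.cast_nonneg m), ← max_add_add_left, max_comm]
    congr 1 <;> ring
  simp only [h]
  have h2 : Integrable (fun x => x + m * t) μ := hi.add (integrable_const _)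
  rw [integral_add h2 ((integrable_max_sub hi t).const_mul _),
    integral_add hi (integrable_const _)]
  simp [psi, integral_const_mul]

/-- Since ψ falls at rate at most 1, `seqA` of the increments is non-negative, which bounds the next
increment below by a multiple of threshold minus mean; the bound by the mean is therefore carried
along. -/
lemma thr_step_nonneg (hi : Integrable (fun x : ℝ => x) μ) (j : ℕ) :
    thr μ (j + 1) ≤ thr μ (j + 2) ∧ ∫ x, x ∂μ ≤ thr μ (j + 1) := by
  induction j with
  | zero =>
    refine ⟨?_, thr_one.ge⟩
    have := succ_mul_thr_succ (μ := μ) 1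
    have h2 := psi_nonneg (μ := μ) (thr μ 1)
    rw [thr_one] at *
    push_cast at this
    norm_num at this ⊢
    linarith
  | succ j ih =>
    refine ⟨?_, ih.2.trans ih.1⟩
    have h1 := seqA_thr (μ := μ) (by omega : 1 ≤ j + 1)
    have h2 := psi_sub_psi_le hi ih.1
    rw [seqA, sum_thr_sub] at h1
    have h3 : 0 ≤ 1 / (((j + 1 : ℕ) : ℝ) * ((j + 1 : ℕ) + 1)) * (thr μ (j + 1 + 1) - ∫ x, x ∂μ) :=
      mul_nonneg (by positivity) (by linarith [ih.1, ih.2])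
    have h4 : 0 ≤ (((j + 1 : ℕ) : ℝ) + 2) / ((j + 1 : ℕ) + 1)
        * (thr μ (j + 1 + 1 + 1) - thr μ (j + 1 + 1)) := by
      simp only [show j + 2 = j + 1 + 1 from rfl] at h2
      linarith
    have := nonneg_of_mul_nonneg_right h4 (by positivity)
    simp only [show j + 1 + 2 = j + 1 + 1 + 1 from rfl]
    linarith

lemma monotone_thr (h0 : μ (Set.Iio 0) = 0) (hi : Integrable (fun x : ℝ => x) μ) :
    Monotone (thr μ) := by
  refine monotone_nat_of_le_succ fun j => ?_
  rcases j with _ | j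
  · rw [thr_zero, thr_one]; exact integral_nonneg_of_ae (ae_nonneg h0)
  · exact (thr_step_nonneg hi j).1

end

/-! ### The offline and online values, and the upper bound -/

lemma E_eq_integral {F : ProbabilityMeasure ℝ} (h0 : (F : Measure ℝ) (Set.Iio 0) = 0)
    (hi : Integrable (fun x : ℝ => x) (F : Measure ℝ)) (n : ℕ) :
    E F n = ∫ x in Set.Ioi 0, P n (cdf (F : Measure ℝ) x) := by
  simp only [P_eq_sum_range]
  rw [E, integral_finsetSum _ fun l _ => integrableOn_one_sub_cdf_pow hi l 0]
  exact Finset.sum_congr rfl fun l _ => integral_max_pi h0 hi l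

lemma mean_le_E {F : ProbabilityMeasure ℝ} (h0 : (F : Measure ℝ) (Set.Iio 0) = 0)
    (hi : Integrable (fun x : ℝ => x) (F : Measure ℝ)) {n : ℕ} (hn : 1 ≤ n) :
    ∫ x, x ∂(F : Measure ℝ) ≤ E F n := by
  rw [E_eq_integral h0 hi, ← psi_zero h0, psi_eq_integral hi]
  exact setIntegral_mono (integrableOn_one_sub_cdf hi 0) (integrableOn_P_cdf hi n 0)
    fun x => one_sub_le_P hn (cdf_nonneg _ x) (cdf_le_one _ x)

lemma G_succ (F : ProbabilityMeasure ℝ) (m : ℕ) :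
    G F (m + 1) = ∫ x, Finset.univ.sup' Finset.univ_nonempty
      (fun k : Fin (m + 1) => ((k : ℕ) + 1 : ℝ) * x + G F (m - (k : ℕ))) ∂(F : Measure ℝ) := by
  rw [G]

lemma G_zero (F : ProbabilityMeasure ℝ) : G F 0 = 0 := by rw [G]

/-- Replacing t_{m-k} by the larger t_m makes the payoff affine in the duration, so an extreme
duration is best; for both extremes the replacement changes nothing. -/
lemma G_eq {F : ProbabilityMeasure ℝ} (h0 : (F : Measure ℝ) (Set.Iio 0) = 0)
    (hi : Integrable (fun x : ℝ => x) (F : Measure ℝ)) (m : ℕ) :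
    G F m = m * thr (F : Measure ℝ) m := by
  induction m using Nat.strong_induction_on with
  | _ m ih =>
    rcases m with _ | m
    · simp [G_zero]
    have hmono := monotone_thr h0 hi
    push_cast
    rw [G_succ, succ_mul_thr_succ, ← integral_max_affine hi]
    refine integral_congr_ae ?_
    filter_upwards [ae_nonneg h0] with x hx
    refine le_antisymm (Finset.sup'_le _ _ fun k _ => ?_) (max_le ?_ ?_)
    · have hk : (k : ℕ) ≤ m := by omega
      rw [ih (m - k) (by omega), Nat.cast_sub hk]
      have h1 : thr (F : Measure ℝ) (m - k) ≤ thr (F : Measure ℝ) m := hmono (by omega)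
      have h2 : (0 : ℝ) ≤ k := Nat.cast_nonneg _
      have h3 : (0 : ℝ) ≤ (m : ℝ) - k := by
        rw [sub_nonneg]; exact_mod_cast hk
      rcases le_total x (thr (F : Measure ℝ) m) with h | h
      · refine le_max_of_le_left ?_
        nlinarith
      · refine le_max_of_le_right ?_
        nlinarith
    · refine le_trans (le_of_eq ?_) (Finset.le_sup' _ (Finset.mem_univ (0 : Fin (m + 1))))
      simp [ih m (by omega)]
    · refine le_trans (le_of_eq ?_) (Finset.le_sup' _ (Finset.mem_univ (Fin.last m)))
      simp [G_zero]

lemma sum_range_succ_eq (f : ℕ → ℝ) (m : ℕ) :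
    ∑ j ∈ Finset.range (m + 1), f j = f 0 + ∑ j ∈ Finset.Icc 1 m, f j := by
  induction m with
  | zero => simp
  | succ m ih => rw [Finset.sum_range_succ, ih, Finset.sum_Icc_succ_top (by omega)]; ring

lemma E_le {n : ℕ} (hn : 2 ≤ n) {e : ℝ} {u : ℕ → ℝ} (h : IsChain n e u)
    (hu : n * (1 + e) = icp n (u 0)) {F : ProbabilityMeasure ℝ}
    (h0 : (F : Measure ℝ) (Set.Iio 0) = 0)
    (hi : Integrable (fun x : ℝ => x) (F : Measure ℝ)) : E F n ≤ (1 + e) * G F n := by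
  set μ := (F : Measure ℝ) with hμ
  have hmono := monotone_thr h0 hi
  set s : ℕ → ℝ := fun j => thr μ (j + 1) - thr μ j with hs
  have htot := h.total hn s
  obtain ⟨m, rfl⟩ : ∃ m, n = m + 2 := ⟨n - 2, by omega⟩
  simp only [Nat.add_sub_cancel, show m + 2 - 1 = m + 1 from rfl] at htot
  have h1 : E F (m + 2) = _ := E_eq_integral h0 hi (m + 2)
  have h2 := integral_Ioi_eq_sum hmono (integrableOn_P_cdf hi (m + 2) (thr μ 0)) (m + 1)
  rw [thr_zero, ← h1, sum_range_succ_eq] at h2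
  -- Tangent at u 0 up to the mean, at u j on the j-th interval, at 1 on the tail.
  have h3 := setIntegral_P_cdf_le hi (m + 2) (hmono (Nat.zero_le 1)) (h.nonneg 0)
  have h4 := Finset.sum_le_sum fun j (_ : j ∈ Finset.Icc 1 m) =>
    setIntegral_P_cdf_le hi (m + 2) (hmono (Nat.le_succ j)) (h.nonneg j)
  have h5 := setIntegral_Ioi_P_cdf_le hi (m + 2) (thr μ (m + 1))
  have h6 : ∑ j ∈ Finset.Icc 1 m, ((thr μ j.succ - thr μ j) * icp (m + 2) (u j)
      - slp (m + 2) (u j) * (thr μ j.succ - thr μ j - psi μ (thr μ j) + psi μ (thr μ j.succ)))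
      = ∑ j ∈ Finset.Icc 1 m, (s j * icp (m + 2) (u j) - slp (m + 2) (u j) * seqA s j) :=
    Finset.sum_congr rfl fun j hj => by rw [hs, seqA_thr (Finset.mem_Icc.1 hj).1]
  rw [h6] at h4
  have h7 := succ_mul_thr_succ (μ := μ) 1
  have h8 := succ_mul_thr_succ (μ := μ) (m + 1)
  have hS : ∀ k, ∑ j ∈ Finset.Icc 1 k, s j = thr μ (k + 1) - ∫ x, x ∂μ := sum_thr_sub
  rw [hS, hS, show s 1 = thr μ 2 - thr μ 1 from rfl, thr_one] at htot
  rw [thr_one] at h7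
  rw [slp_one] at h5
  rw [thr_zero, psi_zero h0, thr_one] at h3
  rw [G_eq h0 hi]
  simp only [zero_add, thr_zero] at h2
  rw [thr_one] at h2
  simp only [show m + 1 + 1 = m + 2 from rfl] at *
  push_cast at *
  have e1 : 2 * slp (m + 2) (u 0) * (thr μ 2 - ∫ x, x ∂μ)
      = slp (m + 2) (u 0) * psi μ (∫ x, x ∂μ) := by
    have : 2 * (thr μ 2 - ∫ x, x ∂μ) = psi μ (∫ x, x ∂μ) := by norm_num at h7; linarith
    rw [← this]; ring
  -- The recursion turns the bracket into (n - 1) ψ(t_{n-1}), so the second part of `L` is the tail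
  -- bound.
  have e2 : ((m : ℝ) + 2) * (m + 2 + 1) / (2 * (m + 2 - 1)) * ((m + 2) * (thr μ (m + 2) - ∫ x, x ∂μ)
      - (m + 2 - 1) * (thr μ (m + 1) - ∫ x, x ∂μ))
      = (m + 2) * (m + 2 + 1) / 2 * psi μ (thr μ (m + 1)) := by
    have : ((m : ℝ) + 2) * (thr μ (m + 2) - ∫ x, x ∂μ)
      - (m + 2 - 1) * (thr μ (m + 1) - ∫ x, x ∂μ) = (m + 1) * psi μ (thr μ (m + 1)) := by
      linarith
    rw [this, show (m : ℝ) + 2 - 1 = m + 1 by ring]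
    field_simp
  rw [e1, e2] at htot
  rw [← hu] at h3
  nlinarith

/-! ### Extremal laws -/

/-- The increments of `v`, starting from `0`. -/
def incr (v : ℕ → ℝ) : ℕ → ℝ
  | 0 => v 0
  | i + 1 => v (i + 1) - v i

lemma incr_nonneg {v : ℕ → ℝ} (hv : Monotone v) (h0 : 0 ≤ v 0) (i : ℕ) : 0 ≤ incr v i := by
  rcases i with _ | i
  · exact h0
  · exact sub_nonneg.2 (hv (Nat.le_succ i))

lemma sum_incr (v : ℕ → ℝ) (j : ℕ) : ∑ i ∈ Finset.range (j + 1), incr v i = v j := by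
  induction j with
  | zero => simp [incr]
  | succ j ih => rw [Finset.sum_range_succ, ih, incr]; ring

/-- The measure with atoms at `x 0, …, x N` and cumulative masses `v 0, …, v N`. -/
noncomputable def stepLaw (x v : ℕ → ℝ) (N : ℕ) : Measure ℝ :=
  ∑ i ∈ Finset.range (N + 1), ENNReal.ofReal (incr v i) • Measure.dirac (x i)

lemma stepLaw_apply_of_mem {x v : ℕ → ℝ} (hv : Monotone v) (h0 : 0 ≤ v 0) {N j : ℕ}
    (hj : j ≤ N) {s : Set ℝ} (hs : MeasurableSet s) (hin : ∀ i ≤ j, x i ∈ s)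
    (hout : ∀ i ≤ N, j < i → x i ∉ s) : stepLaw x v N s = ENNReal.ofReal (v j) := by
  have h1 : stepLaw x v N s
      = ∑ i ∈ Finset.range (N + 1), ENNReal.ofReal (incr v i) * s.indicator 1 (x i) := by
    simp [stepLaw, Measure.finsetSum_apply, Measure.dirac_apply' _ hs]
  rw [h1, ← sum_incr v j, ENNReal.ofReal_sum_of_nonneg fun i _ => incr_nonneg hv h0 i]
  symm
  refine Finset.sum_subset_zero_on_sdiff (Finset.range_subset_range.2 (by omega)) ?_ ?_
  · intro i hi
    simp only [Finset.mem_sdiff, Finset.mem_range] at hi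
    rw [Set.indicator_of_notMem (hout i (by omega) (by omega)), mul_zero]
  · intro i hi
    have := Finset.mem_range.1 hi
    rw [Set.indicator_of_mem (hin i (by omega)), Pi.one_apply, mul_one]

/-- A finitely supported law with prescribed values of the distribution function. -/
lemma exists_law_of_cdf {x v : ℕ → ℝ} (hx : Monotone x) (hx0 : x 0 = 0) (hv : Monotone v)
    (hv0 : 0 ≤ v 0) {N : ℕ} (hvN : v N = 1) : ∃ F : ProbabilityMeasure ℝ,
      (F : Measure ℝ) (Set.Iio 0) = 0 ∧ Integrable (fun y : ℝ => y) (F : Measure ℝ) ∧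
      (∀ j < N, ∀ a, x j ≤ a → a < x (j + 1) → cdf (F : Measure ℝ) a = v j) ∧
      ∀ a, x N ≤ a → cdf (F : Measure ℝ) a = 1 := by
  have huniv : IsProbabilityMeasure (stepLaw x v N) := ⟨by
    rw [stepLaw_apply_of_mem hv hv0 le_rfl MeasurableSet.univ (fun _ _ => Set.mem_univ _)
      (fun i h1 h2 => by omega), hvN, ENNReal.ofReal_one]⟩
  have hIic : ∀ j ≤ N, ∀ a, x j ≤ a → (∀ i ≤ N, j < i → a < x i) →
      cdf (stepLaw x v N) a = v j := by
    intro j hj a h1 h2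
    rw [cdf_eq_real, measureReal_def, stepLaw_apply_of_mem hv hv0 hj measurableSet_Iic
      (fun i hi => (hx hi).trans h1) (fun i hi hji => not_le.2 (h2 i hi hji)),
      ENNReal.toReal_ofReal (hv0.trans (hv (Nat.zero_le j)))]
  refine ⟨⟨stepLaw x v N, huniv⟩, ?_, ?_, fun j hj a h1 h2 => ?_, fun a ha => ?_⟩
  · change stepLaw x v N (Set.Iio 0) = 0
    have hnn : ∀ i, ¬ x i < 0 := fun i => not_lt.2 (hx0 ▸ hx (Nat.zero_le i))
    simp [stepLaw, Measure.finsetSum_apply, Measure.dirac_apply' _ measurableSet_Iio, hnn]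
  · change Integrable (fun y : ℝ => y) (stepLaw x v N)
    exact integrable_finsetSum_measure.2 fun i _ =>
      (integrable_dirac (by simp)).smul_measure ENNReal.ofReal_ne_top
  · exact hIic j hj.le a h1 fun i _ hji => h2.trans_le (hx hji)
  · rw [← hvN]
    exact hIic N le_rfl a ha fun i h1 h2 => by omega

/-- The mean excess over the threshold `crit u j` at the stationary point. -/
noncomputable def critExcess (u : ℕ → ℝ) (j : ℕ) : ℝ :=
  (((j : ℝ) + 1) * critStep u j + crit u j - 1) / j

lemma critExcess_one (u : ℕ → ℝ) : critExcess u 1 = u 0 := by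
  simp [critExcess, critStep_one, crit_one]; ring

/-- This is the drop of the mean excess across an interval of length `critStep u j` on which the
distribution function is constantly u j. -/
lemma critExcess_sub (u : ℕ → ℝ) {j : ℕ} (hj : 1 ≤ j) :
    critExcess u j - critExcess u (j + 1) = (1 - u j) * critStep u j := by
  have h := seqA_critStep u hj
  have hj' : (0 : ℝ) < j := by exact_mod_cast hj
  have e : crit u (j + 1) = crit u j + critStep u j := by rw [critStep]; ring
  rw [one_sub_mul, ← h, seqA, sum_critStep, critExcess, critExcess, e]
  push_cast
  field_simp
  ring

lemma critExcess_nonneg {u : ℕ → ℝ} (hu : ∀ j, 0 < u j) {j : ℕ} (hj : 1 ≤ j) :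
    0 ≤ critExcess u j := by
  obtain ⟨k, rfl⟩ : ∃ k, j = k + 1 := ⟨j - 1, by omega⟩
  have h1 := (critStep_pos hu (k + 1)).1
  have h2 := (critStep_pos hu k).2
  have h3 : 0 ≤ ((k + 1 : ℕ) : ℝ) * critStep u (k + 1) := by positivity
  exact div_nonneg (by linarith) (by positivity)

lemma crit_strictMono {u : ℕ → ℝ} (hu : ∀ j, 0 < u j) : StrictMono (crit u) :=
  strictMono_nat_of_lt_succ fun j => sub_pos.1 (critStep_pos hu j).1

lemma omega0_lt_omega1 {F : ProbabilityMeasure ℝ} {a b : ℝ} (hab : a < b)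
    (ha : 0 < cdf (F : Measure ℝ) a) (hb : cdf (F : Measure ℝ) b < 1) : omega0 F < omega1 F :=
  calc omega0 F ≤ (a : EReal) := sInf_le ⟨a, ha, rfl⟩
    _ < b := by exact_mod_cast hab
    _ ≤ omega1 F := le_sSup ⟨b, hb, rfl⟩

/-- Laws that attain the value of the stationary point in the limit `v → 1`. -/
lemma exists_law {n : ℕ} (hn : 2 ≤ n) {e : ℝ} {u : ℕ → ℝ} (h : IsChain n e u)
    (hu : n * (1 + e) = icp n (u 0)) {v : ℝ} (hv : u (n - 2) ≤ v) (hv1 : v < 1) :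
    ∃ F ∈ distributions, G F n = n * crit u n ∧
      (1 + e) * n * crit u n - critExcess u (n - 1) * (slp n 1 - slp n v) ≤ E F n := by
  obtain ⟨m, rfl⟩ : ∃ m, n = m + 2 := ⟨n - 2, by omega⟩
  simp only [Nat.add_sub_cancel, show m + 2 - 1 = m + 1 from rfl] at hv ⊢
  have hv0 : 0 ≤ v := (h.nonneg m).trans hv
  set Ψ := critExcess u (m + 1) with hΨ
  have hΨ0 : 0 ≤ Ψ := critExcess_nonneg h.pos' (by omega)
  -- The top atom is placed so that (M - crit u (m + 1))(1 - v) = Ψ, the required mean excess over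
  -- the last threshold.
  set M := crit u (m + 1) + Ψ / (1 - v) with hM
  have hmono := (crit_strictMono h.pos').monotone
  have hMge : crit u (m + 1) ≤ M := by
    have : 0 ≤ Ψ / (1 - v) := div_nonneg hΨ0 (by linarith)
    linarith
  set x : ℕ → ℝ := fun j => if j ≤ m + 1 then crit u j else M with hxdef
  set w : ℕ → ℝ := fun j => if j ≤ m then u j else if j = m + 1 then v else 1 with hwdef
  have hx : Monotone x := by
    refine monotone_nat_of_le_succ fun j => ?_
    rcases lt_trichotomy j (m + 1) with hj | hj | hj
    · simp only [hxdef, if_pos hj.le, if_pos (Nat.succ_le_of_lt hj)]; exact hmono (Nat.le_succ j)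
    · simp only [hxdef, hj]; simpa using hMge
    · simp [hxdef, not_le.2 hj, show ¬ j ≤ m by omega]
  have hw : Monotone w := by
    refine monotone_nat_of_le_succ fun j => ?_
    rcases lt_trichotomy j m with hj | hj | hj
    · simp only [hwdef, if_pos hj.le, if_pos (Nat.succ_le_of_lt hj)]; exact h.mono (Nat.le_succ j)
    · simp only [hwdef, hj]; simpa using hv
    · rcases eq_or_ne j (m + 1) with rfl | hj'
      · simpa [hwdef] using hv1.le
      · simp [hwdef, not_le.2 hj, hj', show ¬ j + 1 ≤ m by omega, show j ≠ m by omega]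
  have hx0 : x 0 = 0 := by simp [hxdef, crit_zero]
  have hxc : ∀ j ≤ m + 1, x j = crit u j := fun j hj => if_pos hj
  have hwu : ∀ j ≤ m, w j = u j := fun j hj => if_pos hj
  have hxM : x (m + 2) = M := by simp [hxdef]
  have hwv : w (m + 1) = v := by simp [hwdef]
  obtain ⟨F, hF0, hFi, hF, hFN⟩ := exists_law_of_cdf hx hx0 hw
    (by rw [hwu 0 (by omega)]; exact h.nonneg 0) (N := m + 2) (by simp [hwdef])
  set μ := (F : Measure ℝ) with hμ
  have hpiece : ∀ (g : ℝ → ℝ), ∀ j < m + 2, ∫ y in Set.Ioc (x j) (x (j + 1)), g (cdf μ y)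
      = (x (j + 1) - x j) * g (w j) := by
    intro g j hj
    rw [integral_Ioc_eq_integral_Ioo, setIntegral_congr_fun (g := fun _ => g (w j))
      measurableSet_Ioo fun y hy => by simp only; rw [hF j hj y hy.1.le hy.2], setIntegral_const]
    simp [hx (Nat.le_succ j)]
  have hpsi : ∀ j < m + 2, psi μ (x j) - psi μ (x (j + 1)) = (x (j + 1) - x j) * (1 - w j) :=
    fun j hj => by
      rw [psi_sub_psi hFi (hx (Nat.le_succ j))]
      exact hpiece (fun t => 1 - t) j hj
  have htail : ∀ (g : ℝ → ℝ), g 1 = 0 → ∫ y in Set.Ioi (x (m + 2)), g (cdf μ y) = 0 := by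
    intro g hg
    rw [setIntegral_congr_fun (g := fun _ => (0 : ℝ)) measurableSet_Ioi fun y hy => by
      simp only; rw [hFN y (le_of_lt hy), hg]]
    simp
  have hpsiN : psi μ (x (m + 2)) = 0 := by
    rw [psi_eq_integral hFi]; exact htail (fun t => 1 - t) (by simp)
  -- The excess is known at the right end, where it is 0, so it is identified from right to left.
  have hpsic : ∀ i ≤ m, psi μ (crit u (m + 1 - i)) = critExcess u (m + 1 - i) := by
    intro i
    induction i with
    | zero =>
      intro _
      have := hpsi (m + 1) (by omega)
      rw [hpsiN, hxM, hwv, hxc _ le_rfl, hM] at this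
      have hne : (1 : ℝ) - v ≠ 0 := by linarith
      simp only [Nat.sub_zero]
      rw [← hΨ]
      field_simp at this
      linarith
    | succ i ih =>
      intro hi
      obtain ⟨k, hk⟩ : ∃ k, m = i + 1 + k := ⟨m - (i + 1), by omega⟩
      have ih := ih (by omega)
      have e1 : m + 1 - i = k + 1 + 1 := by omega
      have e2 : m + 1 - (i + 1) = k + 1 := by omega
      rw [e1] at ih
      rw [e2]
      have h1 := hpsi (k + 1) (by omega)
      rw [hxc _ (by omega), hxc _ (by omega), hwu _ (by omega), ih] at h1
      have h2 := critExcess_sub u (j := k + 1) (by omega)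
      rw [critStep] at h2
      linarith
  have hmean : ∫ y, y ∂μ = 1 := by
    have h1 := hpsi 0 (by omega)
    have h2 := hpsic m le_rfl
    rw [show m + 1 - m = 1 by omega, critExcess_one] at h2
    rw [hxc _ (by omega), hxc _ (by omega), hwu _ (by omega), zero_add, crit_zero, psi_zero hF0,
      h2, crit_one] at h1
    linarith
  have hthr : ∀ j ≤ m + 2, thr μ j = crit u j := by
    intro j
    induction j with
    | zero => intro _; rw [thr_zero, crit_zero]
    | succ j ih =>
      intro hj
      rcases j with _ | k
      · rw [thr_one, hmean, crit_one]
      · have h1 := succ_mul_thr_succ (μ := μ) (k + 1)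
        have h2 := hpsic (m - k) (by omega)
        rw [show m + 1 - (m - k) = k + 1 by omega] at h2
        rw [ih (by omega), h2, hmean, critExcess, critStep] at h1
        push_cast at h1
        field_simp at h1
        have h3 : (0 : ℝ) < k + 2 := by positivity
        refine mul_left_cancel₀ h3.ne' ?_
        linarith
  refine ⟨F, ⟨hF0, hFi, by rw [← hμ, hmean]; norm_num, omega0_lt_omega1 (a := x 0)
    (b := x (m + 1)) ?_ ?_ ?_⟩, ?_, ?_⟩
  · rw [hxc _ (by omega), hxc _ le_rfl]
    exact crit_strictMono h.pos' (by omega)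
  · rw [hF 0 (by omega) _ le_rfl (by
      rw [hxc _ (by omega), hxc _ (by omega)]; exact crit_strictMono h.pos' (by omega)),
      hwu _ (by omega)]
    exact h.pos
  · rcases hMge.eq_or_lt with heq | hlt
    · exfalso
      have h1 := (critStep_pos h.pos' (m + 1)).1
      have h2 := (critStep_pos h.pos' m).2
      have h3 : 0 < Ψ := by
        rw [hΨ, critExcess]
        refine div_pos ?_ (by positivity)
        have : 0 < (((m + 1 : ℕ) : ℝ) + 1) * critStep u (m + 1) := by positivity
        linarith
      have : 0 < Ψ / (1 - v) := div_pos h3 (by linarith)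
      linarith
    · rw [hF (m + 1) (by omega) _ le_rfl (by rw [hxc _ le_rfl, hxM]; exact hlt), hwv]
      exact hv1
  · rw [G_eq hF0 hFi, ← hμ, hthr _ le_rfl]
  · have hE := E_eq_integral hF0 hFi (m + 2)
    have hsum := integral_Ioi_eq_sum hx (integrableOn_P_cdf hFi (m + 2) (x 0)) (m + 2)
    rw [htail _ (P_one _), hx0, ← hE, Finset.sum_range_succ, sum_range_succ_eq,
      hpiece _ 0 (by omega), hpiece _ (m + 1) (by omega), Finset.sum_congr rfl fun j hj =>
        hpiece _ j (by have := Finset.mem_Icc.1 hj; omega)] at hsum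
    have htot := h.total hn (critStep u)
    simp only [Nat.add_sub_cancel, show m + 2 - 1 = m + 1 from rfl] at htot
    have hS : ∑ j ∈ Finset.Icc 1 m, (critStep u j * icp (m + 2) (u j)
        - slp (m + 2) (u j) * seqA (critStep u) j)
        = ∑ j ∈ Finset.Icc 1 m, (x (j + 1) - x j) * P (m + 2) (w j) := by
      refine Finset.sum_congr rfl fun j hj => ?_
      have hj := Finset.mem_Icc.1 hj
      rw [seqA_critStep u hj.1, hxc _ (by omega), hxc _ (by omega), hwu _ hj.2, icp, critStep]
      ring
    rw [hS, sum_critStep, sum_critStep, critStep_one] at htot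
    rw [hxc _ (by omega), hxc _ (by omega), hwu _ (by omega), hxM, hwv, hxc _ le_rfl, zero_add,
      crit_one, crit_zero] at hsum
    -- The only loss: the last interval is credited with Ψ slp(v) instead of the tail bound Ψ
    -- slp(1).
    have hlast : Ψ * slp (m + 2) v ≤ (M - crit u (m + 1)) * P (m + 2) v := by
      have h1 := one_sub_mul_slp_le_P (n := m + 2) hv0
      have h2 : 0 < 1 - v := by linarith
      have h3 : M - crit u (m + 1) = Ψ / (1 - v) := by rw [hM]; ring
      rw [h3, div_mul_eq_mul_div, le_div_iff₀ h2]
      nlinarith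
    have e2 : ((m + 2 : ℕ) : ℝ) * (((m + 2 : ℕ) : ℝ) + 1) / (2 * (((m + 2 : ℕ) : ℝ) - 1))
        * (((m + 2 : ℕ) : ℝ) * (crit u (m + 1 + 1) - 1)
          - (((m + 2 : ℕ) : ℝ) - 1) * (crit u (m + 1) - 1))
        = slp (m + 2) 1 * Ψ := by
      rw [slp_one, hΨ, critExcess, critStep]
      push_cast
      rw [show (m : ℝ) + 2 - 1 = m + 1 by ring]
      field_simp
      ring
    rw [e2] at htot
    have e3 : icp (m + 2) (u 0) = P (m + 2) (u 0) + u 0 * slp (m + 2) (u 0) := rfl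
    rw [← hu] at e3
    simp only [show m + 1 + 1 = m + 2 from rfl] at *
    nlinarith

/-! ### The worst-case ratio and ε_n -/

lemma distributions_nonempty : distributions.Nonempty := by
  obtain ⟨e, δ, -, -, ⟨u, hch, hu⟩, -⟩ := exists_isChain (n := 2) le_rfl
  obtain ⟨F, hF, -⟩ := exists_law le_rfl hch hu le_rfl hch.lt_one
  exact ⟨F, hF⟩

lemma E_pos {F : ProbabilityMeasure ℝ} (hF : F ∈ distributions) {n : ℕ} (hn : 1 ≤ n) :
    0 < E F n := hF.2.2.1.trans_le (mean_le_E hF.1 hF.2.1 hn)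

lemma G_nonneg {F : ProbabilityMeasure ℝ} (hF : F ∈ distributions) (n : ℕ) : 0 ≤ G F n := by
  rw [G_eq hF.1 hF.2.1]
  have := monotone_thr hF.1 hF.2.1 (Nat.zero_le n)
  rw [thr_zero] at this
  positivity

lemma G_one_eq_E_one {F : ProbabilityMeasure ℝ} (hF : F ∈ distributions) : G F 1 = E F 1 := by
  rw [G_eq hF.1 hF.2.1, thr_one, E_eq_integral hF.1 hF.2.1, ← psi_zero hF.1,
    psi_eq_integral hF.2.1]
  simp [P]

/-- For the extremal laws `G F n` does not depend on v, so (e - ε) `G F n` stays fixed while the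
loss tends to 0 as v → 1. -/
lemma exists_lt_E {n : ℕ} (hn : 2 ≤ n) {e : ℝ} {u : ℕ → ℝ} (h : IsChain n e u)
    (hu : n * (1 + e) = icp n (u 0)) {ε : ℝ} (hε : ε < e) :
    ∃ F ∈ distributions, (1 + ε) * G F n < E F n := by
  have hpos : 0 < (e - ε) * (n * crit u n) := by
    have h1 := crit_strictMono h.pos' (by omega : 0 < n)
    rw [crit_zero] at h1
    have h2 : (0 : ℝ) < n := by exact_mod_cast (by omega : 0 < n)
    exact mul_pos (sub_pos.2 hε) (mul_pos h2 h1)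
  have hc : Continuous fun v => critExcess u (n - 1) * (slp n 1 - slp n v) := by fun_prop
  have hev : ∀ᶠ v in nhdsWithin 1 (Set.Iio 1),
      critExcess u (n - 1) * (slp n 1 - slp n v) < (e - ε) * (n * crit u n) := by
    refine nhdsWithin_le_nhds (hc.continuousAt.eventually_lt_const ?_)
    simpa using hpos
  obtain ⟨v, hv, hvI⟩ := (hev.and (Ico_mem_nhdsLT h.lt_one)).exists
  obtain ⟨F, hF, hG, hE⟩ := exists_law hn h hu hvI.1 hvI.2
  refine ⟨F, hF, ?_⟩
  rw [hG]
  linarith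

lemma isLeast_ratio {n : ℕ} (hn : 2 ≤ n) {e : ℝ} (he : 0 ≤ e) {u : ℕ → ℝ} (h : IsChain n e u)
    (hu : n * (1 + e) = icp n (u 0)) :
    IsLeast {ε : ℝ | 0 ≤ ε ∧ ∀ F ∈ distributions, 0 ≤ (1 + ε) * G F n - E F n} e := by
  refine ⟨⟨he, fun F hF => sub_nonneg.2 (E_le hn h hu hF.1 hF.2.1)⟩, fun ε hε => ?_⟩
  by_contra hlt
  obtain ⟨F, hF, hFlt⟩ := exists_lt_E hn h hu (not_le.1 hlt)
  linarith [hε.2 F hF]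

lemma gamma_eq {n : ℕ} (hn : 2 ≤ n) {e : ℝ} (he : 0 ≤ e) {u : ℕ → ℝ} (h : IsChain n e u)
    (hu : n * (1 + e) = icp n (u 0)) : gamma n = 1 / (1 + e) := by
  refine csInf_eq_of_forall_ge_of_forall_gt_exists_lt (distributions_nonempty.image _) ?_ ?_
  · rintro _ ⟨F, hF, rfl⟩
    rw [div_le_div_iff₀ (by linarith) (E_pos hF (by omega)), one_mul, mul_comm]
    exact E_le hn h hu hF.1 hF.2.1
  · intro w hw
    have hw0 : 0 < w := lt_trans (by positivity) hw
    have h1 : 1 / w - 1 < e := by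
      rw [div_lt_iff₀ (by linarith)] at hw
      rw [sub_lt_iff_lt_add, div_lt_iff₀ hw0]
      linarith
    obtain ⟨F, hF, hlt⟩ := exists_lt_E hn h hu h1
    refine ⟨_, ⟨F, hF, rfl⟩, ?_⟩
    rw [add_sub_cancel, one_div, inv_mul_lt_iff₀ hw0] at hlt
    rwa [div_lt_iff₀ (E_pos hF (by omega))]

lemma gamma_one : gamma 1 = 1 := by
  have : (fun F : ProbabilityMeasure ℝ => G F 1 / E F 1) '' distributions = {1} := by
    rw [Set.eq_singleton_iff_nonempty_unique_mem]
    refine ⟨distributions_nonempty.image _, ?_⟩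
    rintro _ ⟨F, hF, rfl⟩
    simp only [G_one_eq_E_one hF, div_self (E_pos hF le_rfl).ne']
  rw [gamma, this, csInf_singleton]

lemma eps_one : eps 1 = 0 := by
  refine IsLeast.csInf_eq ⟨⟨le_rfl, fun F hF => ?_⟩, fun ε hε => hε.1⟩
  rw [G_one_eq_E_one hF]
  simp

end POT

theorem theorem1 (n : ℕ) (hn : 1 ≤ n) :
    POT.gamma n = 1 / (1 + POT.eps n) ∧
    (2 ≤ n →
      (∃ ε' : ℝ, POT.eps n ≤ ε' ∧ ∀ ε ∈ Set.Icc (POT.eps n) ε',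
        ((∀ F ∈ POT.distributions, (1 + ε) * POT.G F n ≥ POT.E F n) ↔ 0 ≤ POT.optValue n ε) ∧
        (∃ y ∈ POT.K n,
          HasGradientAt (POT.Upsilon n ε) 0 y ∧
          (∀ z ∈ POT.K n, HasGradientAt (POT.Upsilon n ε) 0 z → z = y) ∧
          (∀ z ∈ POT.K n, z ≠ y → POT.objective n ε y < POT.objective n ε z))) ∧
      (∀ ε : ℝ, 0 ≤ ε → ConvexOn ℝ (POT.K n ∩ POT.dom n) (POT.Upsilon n ε)) ∧
      IsLeast {ε : ℝ | 0 ≤ ε ∧ 0 ≤ POT.optValue n ε} (POT.eps n)) := by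
  rcases hn.eq_or_lt with rfl | hn2
  · exact ⟨by rw [POT.gamma_one, POT.eps_one]; norm_num, fun h => absurd h (by norm_num)⟩
  obtain ⟨e, δ, he, hδ, ⟨u, hch, hu⟩, hall⟩ := POT.exists_isChain hn2
  have heps : POT.eps n = e := (POT.isLeast_ratio hn2 he.le hch hu).csInf_eq
  rw [heps]
  refine ⟨POT.gamma_eq hn2 he.le hch hu, fun _ => ⟨⟨e + δ, by linarith, fun ε hε => ⟨?_, ?_⟩⟩,
    fun ε _ => POT.convexOn_Upsilon n ε, ⟨⟨he.le, POT.optValue_nonneg hn2 hch hu le_rfl⟩,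
      fun ε hε => POT.le_of_optValue_nonneg hn2 hch hu hε.2⟩⟩⟩
  -- On the whole interval ε ≥ e, so both sides of the equivalence hold.
  · refine iff_of_true (fun F hF => ?_) (POT.optValue_nonneg hn2 hch hu hε.1)
    refine (POT.E_le hn2 hch hu hF.1 hF.2.1).trans ?_
    have := POT.G_nonneg hF n
    gcongr
    exact hε.1
  · obtain ⟨w, hw⟩ := hall ε hε
    exact ⟨POT.critPt n w, POT.critPt_mem_K hw.pos', POT.hasGradientAt_critPt hn2 hw,
      fun z hz hg => POT.eq_critPt_of_hasGradientAt hn2 hw hz hg,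
      fun z hz hne => POT.objective_lt hn2 hw hz hne⟩
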